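/- **Theorem 2 (Security and robustness of FedShield-LLM).** All parameters below depend on a security parameter $\lambda$. "Polynomial-time attacker" means a non-uniform probabilistic one (a family of probabilistic programs of size polynomial in $\lambda$), and "negligible" means smaller than every inverse polynomial in $\lambda$. *CKKS.* Let $n\ge 2$ be a power of two, $q\ge 2$, $R_q=\mathbb Z_q[X]/(X^n+1)$, and let $\chi_s,\chi_u,\chi_e$ be probability distributions on $R_q$; $n$ and $\log q$ are polynomially bounded. Key generation draws $s\leftarrow\chi_s$, $e\leftarrow\chi_e$, $a\leftarrow R_q$ uniformly, and sets $\mathsf{pk}=(b,a)$ with $b=-as+e$. A vector of $n/2$ real slots is encoded as a plaintext $m\in R_q$ by the inverse canonical embedding, multiplication with a scale, and rounding; $\mathrm{Enc}_{\mathsf{pk}}(m)=(bu+e_1+m,\;au+e_2)$ with $u\leftarrow\chi_u$ and $e_1,e_2\leftarrow\chi_e$. *Protocol.* There are $N$ clients and $R$ rounds ($N$, $R$, and the dimensions $d,k$ below are polynomially bounded). In round $t$ each client $i$ of a set $\mathcal C_t$ of participants holds a LoRA update $\Delta w_i=A_iB_i$, $A_i\in\mathbb R^{d\times r}$, $B_i\in\mathbb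 R^{r\times k}$, and a mask $m_i\in\{0,1\}^{d\times k}$ that drops $\lfloor p_t\,dk\rfloor$ entries of smallest absolute value, where $p_t\in[0,1]$ is the pruning rate. It packs and encodes $\Delta w_i^p=m_i\odot\Delta w_i$ into $\lceil dk/(n/2)\rceil$ plaintexts and sends their encryptions, with fresh randomness, to the server, which adds the ciphertexts of the participants. A passive adversary consists of the server (or several colluding servers) and a set $C$ of colluding clients. Its view consists of $\mathsf{pk}$, all ciphertexts and aggregated ciphertexts of all rounds, the plaintexts and encryption randomness of the clients in $C$ and, in the variant with decryption, the exact sums over the participants of the encoded plaintexts of each round (the trusted party that holds the secret key decrypts aggregates only). Call the plaintexts of the clients in $C$, together with these sums in the variant with decryption, the *leakage*. The following hold. 1. *Semantic security of CKKS.* If decision Ring-LWE with error distribution $\chi_e$ is hard for polynomial-time attackers, for one sample with a secret from $\chi_s$ and for two samples with a secret from $\chi_u$, then CKKS is IND-CPA secure. 2. *Security of the protocol.* Assume that CKKS is IND-CPA secure. Then for every $C$ and in both variants: - (a) for any two families of client updates with the same leakage, every polynomial-time attacker distinguishes the two views with negligible advantage only; - (b) let the updates, side information $\mathrm{aux}$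 of polynomially bounded length, and a target $\tau$ all depend on random private data with an arbitrary discrete distribution. Then every polynomial-time attacker outputs $\tau$, given the view and $\mathrm{aux}$, with probability at most the best probability (without computational bounds) of guessing $\tau$ from the leakage and $\mathrm{aux}$ alone, plus a negligible term; - (c) in particular, if $x$ is uniform on a finite nonempty set $\mathcal X$ and the updates depend on $x$ in such a way that the leakage does not, then $\Pr[\mathcal A(\text{view})=x]\le 1/|\mathcal X|+\mathrm{negl}(\lambda)$. 3. *Robustness from sparsified aggregation.* In every round, $\operatorname{rank}\Delta w_i\le r$ and $\Delta w_i^p$ has at most $dk-\lfloor p_t\,dk\rfloor$ nonzero entries, for every client $i$. Moreover, for every nonempty set $H\subseteq\mathcal C_t$ of honest clients (possibly a single one, all others colluding), if $p_t\,dk\ge1$, or if $|H|\ge2$ and $dk>0$, then there are matrices $(\Delta w_i')_i\ne(\Delta w_i)_i$ with $\Delta w_i'=\Delta w_i$ for all $i\notin H$ and $$\sum_{i\in\mathcal C_t}m_i\odot\Delta w_i'=\sum_{i\in\mathcal C_t}m_i\odot\Delta w_i ,$$ so that the aggregate does not determine the individual updates. -/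

import Mathlib

open scoped BigOperators

/-! ### Asymptotics in the security parameter -/

/-- `f` is bounded by a polynomial in the security parameter. -/
def PolyBounded (f : ℕ → ℕ) : Prop :=
  ∃ c k : ℕ, ∀ sec, f sec ≤ c * sec ^ k + c

/-- `ε` is negligible: it decays faster than every inverse polynomial. -/
def Negligible (ε : ℕ → ℝ) : Prop :=
  Asymptotics.SuperpolynomialDecay Filter.atTop (fun sec : ℕ => (sec : ℝ)) ε

/-! ### Non-uniform probabilistic polynomial-time attackers

Programs are straight-line programs over registers that hold natural numbers. Every instruction
appends one register. Sums and products are reduced modulo a literal of the instruction that is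
at least `1`, and the bit length of every literal is charged to the size of the program, so a
register is never longer than the program or the inputs, and a program of polynomial size can be
evaluated in polynomial time. Boolean gates are special cases, so that families of programs of
polynomial size compute exactly what families of circuits of polynomial size compute. -/

/-- One instruction; `i`, `j` are the numbers of registers that are already filled. -/
inductive Instr where
  /-- Write the literal `c`. -/
  | const (c : ℕ)
  /-- Addition modulo `M + 1`. -/
  | add (i j M : ℕ)
  /-- Multiplication modulo `M + 1`. -/
  | mul (i j M : ℕ)
  /-- Quotient of the integer division. -/
  | div (i j : ℕ)
  /-- Comparison: `1` if register `i` is smaller than register `j`, else `0`. -/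
  | lt (i j : ℕ)

/-- The value that an instruction computes from the registers `σ`. -/
def Instr.eval (σ : List ℕ) : Instr → ℕ
  | .const c => c
  | .add i j M => (σ.getD i 0 + σ.getD j 0) % (M + 1)
  | .mul i j M => (σ.getD i 0 * σ.getD j 0) % (M + 1)
  | .div i j => σ.getD i 0 / σ.getD j 0
  | .lt i j => if σ.getD i 0 < σ.getD j 0 then 1 else 0

/-- The cost of an instruction: one step plus the bit length of its literal. -/
def Instr.size : Instr → ℕ
  | .const c => 1 + c.size
  | .add _ _ M => 1 + M.size
  | .mul _ _ M => 1 + M.size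
  | .div _ _ => 1
  | .lt _ _ => 1

/-- A straight-line program, with the list of the registers that it outputs. -/
structure Program where
  code : List Instr
  out : List ℕ

/-- Run a program: the inputs fill the first registers. -/
def Program.run (p : Program) (input : List ℕ) : List ℕ :=
  let σ := p.code.foldl (fun σ I => σ ++ [I.eval σ]) input
  p.out.map fun i => σ.getD i 0

def Program.size (p : Program) : ℕ :=
  (p.code.map Instr.size).sum + p.out.length

/-- A probabilistic attacker (for one security parameter): a program that reads, ahead of its
input, `coins` uniformly random bits. -/
structure Attacker where
  coins : ℕ
  prog : Program

def Attacker.size (A : Attacker) : ℕ := A.coins + A.prog.size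

/-- The distribution of the output of the attacker on a given input. -/
noncomputable def Attacker.run (A : Attacker) (input : List ℕ) : PMF (List ℕ) :=
  (PMF.uniformOfFintype (Fin A.coins → Fin 2)).map fun r =>
    A.prog.run (List.ofFn (fun i => (r i : ℕ)) ++ input)

/-- A family of attackers of polynomial size. -/
def PolyTime (A : ℕ → Attacker) : Prop :=
  PolyBounded fun sec => (A sec).size

/-- The probability that a distinguisher with output distribution `μ` outputs the bit `1`. -/
noncomputable def acceptProb (μ : PMF (List ℕ)) : ℝ := (μ [1]).toReal

/-! ### The ring `R_q = ℤ_q[X] / (X ^ n + 1)` -/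

/-- Elements of `ℤ_q[X] / (X ^ n + 1)`, given by their `n` coefficients. Addition is
coefficientwise. -/
abbrev Rq (n q : ℕ) : Type := Fin n → ZMod q

/-- The product of `ℤ_q[X] / (X ^ n + 1)` (negacyclic convolution of the coefficients). -/
def Rq.mul {n q : ℕ} (x y : Rq n q) : Rq n q := fun k =>
  ∑ i : Fin n, ∑ j : Fin n,
    if (i : ℕ) + j = k then x i * y j
    else if (i : ℕ) + j = k + n then -(x i * y j)
    else 0

/-- The class of `∑ i, x i * X ^ i` in `ℤ_q[X] / (X ^ n + 1)`. -/
noncomputable def Rq.toQuotient {n q : ℕ} (x : Rq n q) :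
    AdjoinRoot (Polynomial.X ^ n + 1 : Polynomial (ZMod q)) :=
  ∑ i : Fin n, AdjoinRoot.of _ (x i) * AdjoinRoot.root _ ^ (i : ℕ)

/-- `Rq.mul` is the multiplication of the quotient ring. -/
theorem Rq.toQuotient_mul {n q : ℕ} (x y : Rq n q) :
    (Rq.mul x y).toQuotient = x.toQuotient * y.toQuotient := by
  have hroot : (AdjoinRoot.root (Polynomial.X ^ n + 1 : Polynomial (ZMod q))) ^ n = -1 := by
    have h := AdjoinRoot.eval₂_root (Polynomial.X ^ n + 1 : Polynomial (ZMod q))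
    simp only [Polynomial.eval₂_add, Polynomial.eval₂_pow, Polynomial.eval₂_X,
      Polynomial.eval₂_one] at h
    exact eq_neg_of_add_eq_zero_left h
  unfold Rq.toQuotient Rq.mul
  simp only [map_sum, Finset.sum_mul]
  rw [Finset.sum_comm]
  refine Finset.sum_congr rfl fun i _ => ?_
  rw [Finset.sum_comm, Finset.mul_sum]
  refine Finset.sum_congr rfl fun j _ => ?_
  have hi := i.isLt
  have hj := j.isLt
  by_cases h : (i : ℕ) + j < n
  · rw [Finset.sum_eq_single (⟨i + j, h⟩ : Fin n)]
    · simp only [if_true, map_mul]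
      rw [pow_add]; ring
    · intro b _ hb
      rw [if_neg (fun hc => hb (Fin.ext hc.symm)), if_neg (by omega)]
      simp
    · simp
  · rw [Finset.sum_eq_single (⟨i + j - n, by omega⟩ : Fin n)]
    · rw [if_neg (by simp only; omega), if_pos (by simp only; omega)]
      have e : (i : ℕ) + j = (i + j - n) + n := by omega
      have e2 : (AdjoinRoot.root (Polynomial.X ^ n + 1 : Polynomial (ZMod q))) ^ ((i : ℕ) + j)
          = - AdjoinRoot.root (Polynomial.X ^ n + 1 : Polynomial (ZMod q)) ^ ((i : ℕ) + j - n) := by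
        conv_lhs => rw [e, pow_add, hroot]
        ring
      have e3 := pow_add (AdjoinRoot.root (Polynomial.X ^ n + 1 : Polynomial (ZMod q))) (i : ℕ) j
      simp only [map_neg, map_mul]
      linear_combination (AdjoinRoot.of _ (x i)) * (AdjoinRoot.of _ (y j)) * (e3 - e2)
    · intro b _ hb
      rw [if_neg (by omega), if_neg]
      · simp
      · intro hc
        exact hb (Fin.ext (by simp only; omega))
    · simp

/-- The representation of a ring element as input of a program: its coefficients, as numbers
below `q`. -/
def Rq.words {n q : ℕ} (x : Rq n q) : List ℕ := List.ofFn fun i => (x i).val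

/-- Read a ring element from the positions `start`, …, `start + n - 1` of a list. -/
def Rq.parse {n q : ℕ} (v : List ℕ) (start : ℕ) : Rq n q :=
  fun i => ((v.getD (start + i) 0 : ℕ) : ZMod q)

/-! ### Independent samples -/

/-- The distribution of a family `ι → α` of independent samples of `p`. -/
noncomputable def iidFamily (ι : Type) [Fintype ι] [DecidableEq ι] {α : Type} [Fintype α]
    (p : PMF α) : PMF (ι → α) :=
  PMF.ofFintype (fun f => ∏ i, p (f i)) (by
    have h := Finset.prod_univ_sum (fun _ : ι => (Finset.univ : Finset α)) (fun _ a => p a)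
    rw [Fintype.piFinset_univ] at h
    rw [← h]
    have h1 : ∑ a : α, p a = 1 := by
      rw [← tsum_fintype (L := .unconditional _)]
      exact p.tsum_coe
    simp [h1])

/-! ### The CKKS encryption scheme -/

/-- CKKS parameters for one security parameter: the ring degree is a power of two that is at
least `2`. The distributions of the secret key, of the encryption randomness `u` and of the errors
are arbitrary. -/
structure CKKS where
  /-- The ring degree is `2 ^ (logSlots + 1)`; a plaintext has `2 ^ logSlots` slots. -/
  logSlots : ℕ
  q : ℕ
  one_lt_q : 1 < q
  /-- The scaling factor of the encoding. -/
  scale : ℝ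
  scale_pos : 0 < scale
  /-- Secret keys. -/
  χs : PMF (Rq (2 ^ (logSlots + 1)) q)
  /-- Encryption randomness. -/
  χu : PMF (Rq (2 ^ (logSlots + 1)) q)
  /-- Errors. -/
  χe : PMF (Rq (2 ^ (logSlots + 1)) q)

namespace CKKS

/-- The number of slots of a plaintext. -/
def slots (P : CKKS) : ℕ := 2 ^ P.logSlots

/-- The ring degree. -/
def degree (P : CKKS) : ℕ := 2 ^ (P.logSlots + 1)

instance (P : CKKS) : NeZero P.q := ⟨by have := P.one_lt_q; omega⟩

/-- The ring `R_q` of the parameters. -/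
abbrev Ring (P : CKKS) : Type := Rq (2 ^ (P.logSlots + 1)) P.q

/-- Key generation: the public key is `(b, a)` with `b = -a * s + e`, the secret key is `s`. -/
noncomputable def keyGen (P : CKKS) : PMF ((P.Ring × P.Ring) × P.Ring) :=
  P.χs.bind fun s => P.χe.bind fun e =>
    (PMF.uniformOfFintype P.Ring).bind fun a => PMF.pure ((-(Rq.mul a s) + e, a), s)

/-- The random input `(u, e₁, e₂)` of one encryption. -/
abbrev Coins (P : CKKS) : Type := P.Ring × P.Ring × P.Ring

noncomputable def coinDist (P : CKKS) : PMF P.Coins :=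
  P.χu.bind fun u => P.χe.bind fun e₁ => P.χe.bind fun e₂ => PMF.pure (u, e₁, e₂)

/-- Encryption of `m` under `pk = (b, a)`: `(b * u + e₁ + m, a * u + e₂)`. -/
def encrypt (P : CKKS) (pk : P.Ring × P.Ring) (m : P.Ring) (ρ : P.Coins) : P.Ring × P.Ring :=
  (Rq.mul pk.1 ρ.1 + ρ.2.1 + m, Rq.mul pk.2 ρ.1 + ρ.2.2)

/-- Scaling and encoding of a vector `z` of real slots: the coefficients of the real polynomial
`m` of degree less than `n` with `m (exp (π * I * 5 ^ s / n)) = z s` for every slot `s` (the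
inverse of the canonical embedding), multiplied by the scale and rounded. -/
noncomputable def encode (P : CKKS) (z : Fin P.slots → ℝ) : P.Ring := fun k =>
  ((round (P.scale * (2 / (P.degree : ℝ) *
    ∑ s : Fin P.slots, z s * Real.cos (Real.pi * 5 ^ (s : ℕ) * (k : ℕ) / P.degree))) : ℤ) :
      ZMod P.q)

/-- Public keys and ciphertexts as inputs of programs. -/
def pairWords {P : CKKS} (c : P.Ring × P.Ring) : List ℕ := Rq.words c.1 ++ Rq.words c.2

end CKKS

/-! ### Ring-LWE -/

/-- `k` Ring-LWE samples `(aᵢ, aᵢ * s + eᵢ)` with one secret `s` drawn from `χ`. -/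
noncomputable def rlweSamples (P : CKKS) (χ : PMF P.Ring) (k : ℕ) :
    PMF (Fin k → P.Ring × P.Ring) :=
  χ.bind fun s => iidFamily (Fin k) <|
    (PMF.uniformOfFintype P.Ring).bind fun a => P.χe.bind fun e =>
      PMF.pure (a, Rq.mul a s + e)

/-- `k` uniformly random pairs. -/
noncomputable def uniformSamples (P : CKKS) (k : ℕ) : PMF (Fin k → P.Ring × P.Ring) :=
  PMF.uniformOfFintype (Fin k → P.Ring × P.Ring)

def sampleWords {P : CKKS} {k : ℕ} (x : Fin k → P.Ring × P.Ring) : List ℕ :=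
  (List.finRange k).flatMap fun i => CKKS.pairWords (x i)

/-- The decision Ring-LWE assumption for secrets from `χ`, errors from `χe` and `k` samples. -/
def RLWEHard (P : ℕ → CKKS) (χ : ∀ sec, PMF (P sec).Ring) (k : ℕ) : Prop :=
  ∀ A : ℕ → Attacker, PolyTime A → Negligible fun sec =>
    |acceptProb ((rlweSamples (P sec) (χ sec) k).bind fun x => (A sec).run (sampleWords x)) -
      acceptProb ((uniformSamples (P sec) k).bind fun x => (A sec).run (sampleWords x))|

/-! ### IND-CPA security of CKKS -/

/-- The IND-CPA experiment with challenge bit `β`: on input of the public key the attacker `A₁`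
outputs a list, whose first `2 n` entries are two messages `m₀`, `m₁` and which as a whole is the
state that is handed over; `A₂` gets the public key, an encryption of `m_β` and the state. -/
noncomputable def indCPAExp (P : CKKS) (A₁ A₂ : Attacker) (β : Bool) : PMF (List ℕ) :=
  P.keyGen.bind fun keys => (A₁.run (CKKS.pairWords keys.1)).bind fun v =>
    P.coinDist.bind fun ρ =>
      let m : P.Ring := if β then Rq.parse v P.degree else Rq.parse v 0
      A₂.run (CKKS.pairWords keys.1 ++ CKKS.pairWords (P.encrypt keys.1 m ρ) ++ v)

/-- CKKS is IND-CPA (semantically) secure. -/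
def INDCPASecure (P : ℕ → CKKS) : Prop :=
  ∀ A₁ A₂ : ℕ → Attacker, PolyTime A₁ → PolyTime A₂ → Negligible fun sec =>
    |acceptProb (indCPAExp (P sec) (A₁ sec) (A₂ sec) true) -
      acceptProb (indCPAExp (P sec) (A₁ sec) (A₂ sec) false)|

/-! ### The FedShield-LLM protocol -/

/-- The public data of a run: `clients` clients, `rounds` rounds, LoRA factors of the shapes
`d × r` and `r × k`, the participants and the pruning rate of every round. -/
structure FedShield where
  clients : ℕ
  rounds : ℕ
  d : ℕ
  r : ℕ
  k : ℕ
  participants : Fin rounds → Finset (Fin clients)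
  rate : Fin rounds → ℝ
  rate_nonneg : ∀ t, 0 ≤ rate t
  rate_le_one : ∀ t, rate t ≤ 1

/-- The local result of a client in one round: the LoRA factors and the support of a mask of
unstructured magnitude pruning with rate `p` for their product. The mask drops `⌊p * d * k⌋`
entries, and no dropped entry is larger in absolute value than a kept one (ties may be broken in
any way). -/
structure ClientUpdate (d r k : ℕ) (p : ℝ) where
  A : Matrix (Fin d) (Fin r) ℝ
  B : Matrix (Fin r) (Fin k) ℝ
  kept : Finset (Fin d × Fin k)
  card_dropped : keptᶜ.card = ⌊p * (d * k : ℕ)⌋₊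
  kept_largest : ∀ x ∈ kept, ∀ y ∉ kept, |(A * B) y.1 y.2| ≤ |(A * B) x.1 x.2|

/-- Entrywise product of a matrix with the `0`/`1` mask that has the support `S`. -/
def maskMul {d k : ℕ} (S : Finset (Fin d × Fin k)) (W : Matrix (Fin d) (Fin k) ℝ) :
    Matrix (Fin d) (Fin k) ℝ :=
  Matrix.of fun i j => if (i, j) ∈ S then W i j else 0

namespace ClientUpdate

variable {d r k : ℕ} {p : ℝ}

/-- The LoRA update `Δw = A * B`. -/
def lora (U : ClientUpdate d r k p) : Matrix (Fin d) (Fin k) ℝ := U.A * U.B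

/-- The pruned update `Δwᵖ = m ⊙ Δw`. -/
def pruned (U : ClientUpdate d r k p) : Matrix (Fin d) (Fin k) ℝ := maskMul U.kept U.lora

end ClientUpdate

/-- The number `⌈d * k / slots⌉` of ciphertexts into which a `d × k` matrix is packed. -/
def numBlocks (P : CKKS) (d k : ℕ) : ℕ := (d * k + P.slots - 1) / P.slots

/-- Packing and encoding of a matrix: the entries in row-major order fill the slots of the
plaintexts one after the other, the remaining slots are `0`. -/
noncomputable def packEncode (P : CKKS) {d k : ℕ} (W : Matrix (Fin d) (Fin k) ℝ)
    (j : Fin (numBlocks P d k)) : P.Ring :=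
  P.encode fun s =>
    if h : (j : ℕ) * P.slots + s < d * k then
      let x := finProdFinEquiv.symm (⟨(j : ℕ) * P.slots + s, h⟩ : Fin (d * k))
      W x.1 x.2
    else 0

namespace FedShield

/-- The local results of all clients in all rounds. -/
abbrev Updates (F : FedShield) : Type :=
  (t : Fin F.rounds) → Fin F.clients → ClientUpdate F.d F.r F.k (F.rate t)

/-- The plaintexts that the clients encrypt: the encoded pruned updates. -/
noncomputable def plaintext (F : FedShield) (P : CKKS) (U : F.Updates) (t : Fin F.rounds)
    (i : Fin F.clients) (j : Fin (numBlocks P F.d F.k)) : P.Ring :=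
  packEncode P (U t i).pruned j

/-- Indices of the encryptions of a run: round, client, block. -/
abbrev Index (F : FedShield) (P : CKKS) : Type :=
  Fin F.rounds × Fin F.clients × Fin (numBlocks P F.d F.k)

/-- What the adversary sees in round `t`. The server sees the ciphertexts of all participants and
their homomorphic sums. The colluding clients `C` reveal their plaintexts and their encryption
randomness. If `dec` is true, the decrypted aggregates are seen as well. -/
noncomputable def roundView (F : FedShield) (P : CKKS) (C : Finset (Fin F.clients)) (dec : Bool)
    (U : F.Updates) (pk : P.Ring × P.Ring) (ρ : F.Index P → P.Coins) (t : Fin F.rounds) :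
    List ℕ :=
  let m := F.plaintext P U t
  let c := fun i j => P.encrypt pk (m i j) (ρ (t, i, j))
  let blocks := List.finRange (numBlocks P F.d F.k)
  ((List.finRange F.clients).flatMap fun i =>
    if i ∈ F.participants t then
      blocks.flatMap fun j =>
        CKKS.pairWords (c i j) ++
          if i ∈ C then
            Rq.words (m i j) ++ Rq.words (ρ (t, i, j)).1 ++
              Rq.words (ρ (t, i, j)).2.1 ++ Rq.words (ρ (t, i, j)).2.2
          else []
    else []) ++
  blocks.flatMap fun j =>
    CKKS.pairWords (∑ i ∈ F.participants t, c i j) ++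
      if dec then Rq.words (∑ i ∈ F.participants t, m i j) else []

/-- The view of the adversary in a run of the protocol: the public key and all rounds. -/
noncomputable def view (F : FedShield) (P : CKKS) (C : Finset (Fin F.clients)) (dec : Bool)
    (U : F.Updates) : PMF (List ℕ) :=
  P.keyGen.bind fun keys => (iidFamily (F.Index P) P.coinDist).map fun ρ =>
    CKKS.pairWords keys.1 ++
      (List.finRange F.rounds).flatMap fun t => F.roundView P C dec U keys.1 ρ t

/-- The part of the plaintext data that the adversary holds anyway: the plaintexts of the
colluding clients and, if `dec` is true, the aggregates. -/
noncomputable def leakage (F : FedShield) (P : CKKS) (C : Finset (Fin F.clients)) (dec : Bool)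
    (U : F.Updates) :
    (F.Index P → P.Ring) × (Fin F.rounds → Fin (numBlocks P F.d F.k) → P.Ring) :=
  (fun x => if x.2.1 ∈ C ∩ F.participants x.1 then F.plaintext P U x.1 x.2.1 x.2.2 else 0,
    fun t j => if dec then ∑ i ∈ F.participants t, F.plaintext P U t i j else 0)

end FedShield

/-! ### Inference attacks -/

/-- The probability that an attacker who sees the view of a run and the side information `aux`
outputs the target `τ`, where updates, side information and target depend on private data `ω` that
is drawn from `D`. -/
noncomputable def inferenceProb (F : FedShield) (P : CKKS) (C : Finset (Fin F.clients))
    (dec : Bool) {Ω : Type} (D : PMF Ω) (U : Ω → F.Updates) (aux τ : Ω → List ℕ)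
    (A : Attacker) : ℝ :=
  ((D.bind fun ω => (F.view P C dec (U ω)).bind fun v =>
    (A.run (v ++ aux ω)).map fun y => decide (y = τ ω)) true).toReal

/-- The best probability of guessing `τ ω` from `ℓ ω` alone, without computational bounds. -/
noncomputable def guessProb {Ω L : Type} (D : PMF Ω) (ℓ : Ω → L) (τ : Ω → List ℕ) : ℝ :=
  (⨆ g : L → List ℕ, (D.map fun ω => decide (g (ℓ ω) = τ ω)) true).toReal

/-- The total bit length of a list of numbers. -/
def bitLength (v : List ℕ) : ℕ := (v.map fun x => x.size + 1).sum

/-! ### Polynomial bounds and negligible functions -/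

namespace PolyBounded

theorem of_le {f g : ℕ → ℕ} (hg : PolyBounded g) (h : ∀ n, f n ≤ g n) : PolyBounded f := by
  obtain ⟨c, k, hc⟩ := hg
  exact ⟨c, k, fun n => (h n).trans (hc n)⟩

theorem const (c : ℕ) : PolyBounded fun _ => c :=
  ⟨c, 0, fun _ => by simp⟩

theorem exists_le_pow {f : ℕ → ℕ} (hf : PolyBounded f) :
    ∃ c k : ℕ, ∀ n, f n ≤ c * (n + 1) ^ k := by
  obtain ⟨c, k, hc⟩ := hf
  refine ⟨2 * c, k, fun n => (hc n).trans ?_⟩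
  have h1 : n ^ k ≤ (n + 1) ^ k := Nat.pow_le_pow_left (Nat.le_succ n) k
  have h2 : 1 ≤ (n + 1) ^ k := Nat.one_le_pow _ _ (Nat.succ_pos n)
  nlinarith [Nat.mul_le_mul_left c h1, Nat.mul_le_mul_left c h2]

theorem of_le_pow {f : ℕ → ℕ} {c k : ℕ} (h : ∀ n, f n ≤ c * (n + 1) ^ k) : PolyBounded f := by
  refine ⟨c * 2 ^ k, k, fun n => (h n).trans ?_⟩
  rcases Nat.eq_zero_or_pos n with rfl | hn
  · simp only [zero_add, one_pow, mul_one]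
    exact (Nat.le_mul_of_pos_right c (by positivity)).trans (Nat.le_add_left _ _)
  · have h1 : (n + 1) ^ k ≤ (2 * n) ^ k := Nat.pow_le_pow_left (by omega) k
    rw [mul_pow] at h1
    calc c * (n + 1) ^ k ≤ c * (2 ^ k * n ^ k) := Nat.mul_le_mul_left c h1
      _ = c * 2 ^ k * n ^ k := by ring
      _ ≤ _ := Nat.le_add_right _ _

theorem add {f g : ℕ → ℕ} (hf : PolyBounded f) (hg : PolyBounded g) :
    PolyBounded fun n => f n + g n := by
  obtain ⟨c, k, hc⟩ := hf.exists_le_pow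
  obtain ⟨c', k', hc'⟩ := hg.exists_le_pow
  refine of_le_pow (c := c + c') (k := k + k') fun n => ?_
  have h1 : (n + 1) ^ k ≤ (n + 1) ^ (k + k') :=
    Nat.pow_le_pow_right (Nat.succ_pos n) (Nat.le_add_right _ _)
  have h2 : (n + 1) ^ k' ≤ (n + 1) ^ (k + k') :=
    Nat.pow_le_pow_right (Nat.succ_pos n) (Nat.le_add_left _ _)
  calc f n + g n ≤ c * (n + 1) ^ k + c' * (n + 1) ^ k' := Nat.add_le_add (hc n) (hc' n)
    _ ≤ c * (n + 1) ^ (k + k') + c' * (n + 1) ^ (k + k') := by gcongr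
    _ = _ := by ring

theorem mul {f g : ℕ → ℕ} (hf : PolyBounded f) (hg : PolyBounded g) :
    PolyBounded fun n => f n * g n := by
  obtain ⟨c, k, hc⟩ := hf.exists_le_pow
  obtain ⟨c', k', hc'⟩ := hg.exists_le_pow
  refine of_le_pow (c := c * c') (k := k + k') fun n => ?_
  calc f n * g n ≤ c * (n + 1) ^ k * (c' * (n + 1) ^ k') := Nat.mul_le_mul (hc n) (hc' n)
    _ = _ := by ring

end PolyBounded

namespace Negligible

theorem of_abs_le {ε δ : ℕ → ℝ} (hδ : Negligible δ) (h : ∀ n, |ε n| ≤ |δ n|) : Negligible ε :=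
  Asymptotics.SuperpolynomialDecay.trans_abs_le hδ h

theorem polyBounded_mul {ε : ℕ → ℝ} (hε : Negligible ε) {f : ℕ → ℕ} (hf : PolyBounded f) :
    Negligible fun n => (f n : ℝ) * ε n := by
  obtain ⟨c, k, hc⟩ := hf
  have h1 : Negligible fun n => (c : ℝ) * ((n : ℝ) ^ k * ε n) + c * ε n :=
    ((hε.param_pow_mul k).const_mul (c : ℝ)).add (hε.const_mul (c : ℝ))
  refine h1.of_abs_le fun n => ?_
  have h2 : (f n : ℝ) ≤ c * (n : ℝ) ^ k + c := by exact_mod_cast hc n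
  have h3 : (c : ℝ) * ((n : ℝ) ^ k * ε n) + c * ε n = (c * (n : ℝ) ^ k + c) * ε n := by ring
  have h4 : (0 : ℝ) ≤ f n := Nat.cast_nonneg _
  rw [h3, abs_mul, abs_mul, abs_of_nonneg h4, abs_of_nonneg (h4.trans h2)]
  gcongr

/-- If every family of objects of polynomial size has negligible advantage, then the advantage
of all objects below a given polynomial size is bounded by one negligible function. -/
theorem exists_uniform_bound {α : Type} [Inhabited α] (size : α → ℕ) (adv : ℕ → α → ℝ)
    (h0 : ∀ n a, 0 ≤ adv n a) (h1 : ∀ n a, adv n a ≤ 1)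
    (h : ∀ A : ℕ → α, PolyBounded (fun n => size (A n)) → Negligible fun n => adv n (A n))
    {b : ℕ → ℕ} (hb : PolyBounded b) :
    ∃ ε : ℕ → ℝ, Negligible ε ∧ (∀ n, 0 ≤ ε n) ∧ ∀ n a, size a ≤ b n → adv n a ≤ ε n := by
  classical
  have key : ∀ n, ∃ a : α, size a ≤ b n + size (default : α) ∧
      ∀ a', size a' ≤ b n → adv n a' ≤ 2 * adv n a := by
    intro n
    by_cases hz : ∀ a', size a' ≤ b n → adv n a' ≤ 0
    · exact ⟨default, Nat.le_add_left _ _, fun a' ha' => (hz a' ha').trans (by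
        have := h0 n default; positivity)⟩
    · push Not at hz
      obtain ⟨a₀, ha₀, hpos⟩ := hz
      set S : Set ℝ := adv n '' {a | size a ≤ b n} with hS
      have hbdd : BddAbove S := ⟨1, by rintro _ ⟨a, -, rfl⟩; exact h1 n a⟩
      have hmem : adv n a₀ ∈ S := ⟨a₀, ha₀, rfl⟩
      have hsup : 0 < sSup S := hpos.trans_le (le_csSup hbdd hmem)
      obtain ⟨_, ⟨a, ha, rfl⟩, hlt⟩ := exists_lt_of_lt_csSup ⟨_, hmem⟩ (half_lt_self hsup)
      refine ⟨a, (show size a ≤ b n from ha).trans (Nat.le_add_right _ _), fun a' ha' => ?_⟩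
      have : adv n a' ≤ sSup S := le_csSup hbdd ⟨a', ha', rfl⟩
      linarith
  choose A hA hA' using key
  refine ⟨fun n => 2 * adv n (A n), ?_, fun n => mul_nonneg zero_le_two (h0 n _),
    fun n a ha => hA' n a ha⟩
  exact (h A ((hb.add (PolyBounded.const _)).of_le hA)).const_mul 2

end Negligible

/-! ### Expectations over finite probability spaces -/

/-- The expectation of a real function on a finite probability space. -/
noncomputable def expect {α : Type} [Fintype α] (μ : PMF α) (f : α → ℝ) : ℝ :=
  ∑ x, (μ x).toReal * f x

section Expect

variable {α β γ : Type} [Fintype α] [Fintype β] [Fintype γ]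

theorem sum_toReal_eq_one (μ : PMF α) : ∑ x, (μ x).toReal = 1 := by
  have h : ∑ x, μ x = 1 := by
    rw [← tsum_fintype (L := .unconditional _)]
    exact μ.tsum_coe
  rw [← ENNReal.toReal_sum fun x _ => μ.apply_ne_top x, h, ENNReal.toReal_one]

@[simp] theorem expect_const (μ : PMF α) (c : ℝ) : expect μ (fun _ => c) = c := by
  rw [expect, ← Finset.sum_mul, sum_toReal_eq_one, one_mul]

theorem abs_expect_sub_le (μ : PMF α) {f g : α → ℝ} {ε : ℝ} (h : ∀ x, |f x - g x| ≤ ε) :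
    |expect μ f - expect μ g| ≤ ε := by
  rw [expect, expect, ← Finset.sum_sub_distrib]
  calc |∑ x, ((μ x).toReal * f x - (μ x).toReal * g x)|
      ≤ ∑ x, |(μ x).toReal * f x - (μ x).toReal * g x| := Finset.abs_sum_le_sum_abs _ _
    _ ≤ ∑ x, (μ x).toReal * ε := Finset.sum_le_sum fun x _ => by
        rw [← mul_sub, abs_mul, abs_of_nonneg ENNReal.toReal_nonneg]
        exact mul_le_mul_of_nonneg_left (h x) ENNReal.toReal_nonneg
    _ = ε := by rw [← Finset.sum_mul, sum_toReal_eq_one, one_mul]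

theorem expect_comm (μ : PMF α) (ν : PMF β) (f : α → β → ℝ) :
    expect μ (fun x => expect ν (f x)) = expect ν fun y => expect μ fun x => f x y := by
  simp only [expect, Finset.mul_sum]
  rw [Finset.sum_comm]
  refine Finset.sum_congr rfl fun y _ => Finset.sum_congr rfl fun x _ => ?_
  ring

theorem toReal_bind_apply {δ : Type} (μ : PMF α) (k : α → PMF δ) (d : δ) :
    ((μ.bind k) d).toReal = expect μ fun x => (k x d).toReal := by
  rw [PMF.bind_apply, tsum_fintype, ENNReal.toReal_sum]
  · simp only [ENNReal.toReal_mul, expect]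
  · exact fun x _ => ENNReal.mul_ne_top (μ.apply_ne_top x) ((k x).apply_ne_top d)

theorem expect_bind (μ : PMF α) (k : α → PMF β) (f : β → ℝ) :
    expect (μ.bind k) f = expect μ fun x => expect (k x) f := by
  simp only [expect, toReal_bind_apply, Finset.mul_sum, Finset.sum_mul]
  rw [Finset.sum_comm]
  refine Finset.sum_congr rfl fun y _ => Finset.sum_congr rfl fun x _ => ?_
  ring

@[simp] theorem expect_pure (a : α) (f : α → ℝ) : expect (PMF.pure a) f = f a := by
  classical
  rw [expect, Finset.sum_eq_single a]
  · simp [PMF.pure_apply]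
  · intro b _ hb
    simp [PMF.pure_apply, hb]
  · simp

theorem acceptProb_bind (μ : PMF α) (k : α → PMF (List ℕ)) :
    acceptProb (μ.bind k) = expect μ fun x => acceptProb (k x) :=
  toReal_bind_apply μ k [1]

theorem acceptProb_pure (v : List ℕ) : acceptProb (PMF.pure v) = if v = [1] then 1 else 0 := by
  rw [acceptProb, PMF.pure_apply]
  by_cases h : v = [1]
  · simp [h]
  · simp [h, Ne.symm h]

theorem acceptProb_nonneg (μ : PMF (List ℕ)) : 0 ≤ acceptProb μ := ENNReal.toReal_nonneg

theorem acceptProb_le_one (μ : PMF (List ℕ)) : acceptProb μ ≤ 1 :=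
  ENNReal.toReal_le_of_le_ofReal zero_le_one (by simpa using μ.coe_le_one [1])

theorem abs_acceptProb_sub_le_one (μ ν : PMF (List ℕ)) :
    |acceptProb μ - acceptProb ν| ≤ 1 := by
  have h1 := acceptProb_nonneg μ
  have h2 := acceptProb_nonneg ν
  have h3 := acceptProb_le_one μ
  have h4 := acceptProb_le_one ν
  rw [abs_le]
  constructor <;> linarith

theorem expect_uniform [Nonempty α] (f : α → ℝ) :
    expect (PMF.uniformOfFintype α) f = (Fintype.card α : ℝ)⁻¹ * ∑ x, f x := by
  simp [expect, Finset.mul_sum]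

theorem expect_uniform_equiv [Nonempty α] [Nonempty β] (e : α ≃ β) (f : β → ℝ) :
    expect (PMF.uniformOfFintype α) (fun x => f (e x)) = expect (PMF.uniformOfFintype β) f := by
  rw [expect_uniform, expect_uniform, e.sum_comp f, Fintype.card_congr e]

theorem expect_uniform_prod [Nonempty α] [Nonempty β] (f : α × β → ℝ) :
    expect (PMF.uniformOfFintype (α × β)) f =
      expect (PMF.uniformOfFintype α) fun x => expect (PMF.uniformOfFintype β) fun y => f (x, y) := by
  simp only [expect_uniform, Fintype.sum_prod_type, Fintype.card_prod, Nat.cast_mul, mul_inv,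
    Finset.mul_sum, mul_assoc]

end Expect

section Iid

variable {ι : Type} [Fintype ι] [DecidableEq ι] {α : Type} [Fintype α]

theorem toReal_iidFamily_apply (p : PMF α) (f : ι → α) :
    (iidFamily ι p f).toReal = ∏ i, (p (f i)).toReal := by
  rw [iidFamily, PMF.ofFintype_apply, ENNReal.toReal_prod]

/-- One member of an independent family can be drawn afresh. -/
theorem expect_iidFamily_update (p : PMF α) (x : ι) (g : (ι → α) → ℝ) :
    expect (iidFamily ι p) g =
      expect (iidFamily ι p) fun f => expect p fun c => g (Function.update f x c) := by
  have hinv : Function.Involutive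
      (fun z : (ι → α) × α => (Function.update z.1 x z.2, z.1 x)) := by
    rintro ⟨f, c⟩
    simp
  have hw : ∀ (f : ι → α) (c : α),
      (∏ i, (p (Function.update f x c i)).toReal) * (p (f x)).toReal =
        (∏ i, (p (f i)).toReal) * (p c).toReal := by
    intro f c
    have h1 := Finset.mul_prod_erase Finset.univ (fun i => (p (f i)).toReal) (Finset.mem_univ x)
    have h2 := Finset.mul_prod_erase Finset.univ
      (fun i => (p (Function.update f x c i)).toReal) (Finset.mem_univ x)
    have h3 : ∏ i ∈ Finset.univ.erase x, (p (Function.update f x c i)).toReal =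
        ∏ i ∈ Finset.univ.erase x, (p (f i)).toReal :=
      Finset.prod_congr rfl fun i hi => by
        rw [Function.update_of_ne (Finset.ne_of_mem_erase hi)]
    rw [← h1, ← h2, h3]
    simp only [Function.update_self]
    ring
  calc expect (iidFamily ι p) g
      = expect (iidFamily ι p) fun f => expect p fun _ => g f := by simp
    _ = ∑ z : (ι → α) × α, (∏ i, (p (z.1 i)).toReal) * (p z.2).toReal * g z.1 := by
        simp only [expect, toReal_iidFamily_apply, Fintype.sum_prod_type, Finset.mul_sum,
          mul_assoc]
    _ = ∑ z : (ι → α) × α, (∏ i, (p (z.1 i)).toReal) * (p z.2).toReal *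
          g (Function.update z.1 x z.2) := by
        rw [← (Equiv.sum_comp hinv.toPerm)]
        refine Finset.sum_congr rfl fun z _ => ?_
        simp only [Function.Involutive.coe_toPerm, hw]
    _ = _ := by
        simp only [expect, toReal_iidFamily_apply, Fintype.sum_prod_type, Finset.mul_sum,
          mul_assoc]

theorem expect_iidFamily_one (p : PMF α) (g : (Fin 1 → α) → ℝ) :
    expect (iidFamily (Fin 1) p) g = expect p fun x => g fun _ => x := by
  rw [expect_iidFamily_update p 0]
  have h : ∀ (f : Fin 1 → α) c, Function.update f 0 c = fun _ => c := fun f c => by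
    funext i
    rw [Subsingleton.elim i 0, Function.update_self]
  simp [h]

theorem expect_iidFamily_two (p : PMF α) (g : (Fin 2 → α) → ℝ) :
    expect (iidFamily (Fin 2) p) g = expect p fun x => expect p fun y => g ![x, y] := by
  rw [expect_iidFamily_update p 0]
  have h : ∀ (f : Fin 2 → α) c c', Function.update (Function.update f 1 c') 0 c = ![c, c'] :=
    fun f c c' => by
      funext i
      fin_cases i <;> simp
  rw [expect_iidFamily_update p 1]
  simp only [h, expect_const]
  exact expect_comm _ _ _

end Iid

/-! ### Composition of straight-line programs -/

/-- Renaming of the registers that an instruction reads. -/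
def Instr.rename (f : ℕ → ℕ) : Instr → Instr
  | .const c => .const c
  | .add i j M => .add (f i) (f j) M
  | .mul i j M => .mul (f i) (f j) M
  | .div i j => .div (f i) (f j)
  | .lt i j => .lt (f i) (f j)

@[simp] theorem Instr.size_rename (f : ℕ → ℕ) (I : Instr) : (I.rename f).size = I.size := by
  cases I <;> rfl

theorem Instr.eval_rename {f : ℕ → ℕ} {σ τ : List ℕ} (h : ∀ i, σ.getD (f i) 0 = τ.getD i 0)
    (I : Instr) : (I.rename f).eval σ = I.eval τ := by
  cases I <;> simp only [Instr.rename, Instr.eval, h]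

namespace Program

/-- The registers that a list of instructions appends to `σ`. -/
def values : List Instr → List ℕ → List ℕ
  | [], _ => []
  | I :: l, σ => I.eval σ :: values l (σ ++ [I.eval σ])

@[simp] theorem length_values (l : List Instr) (σ : List ℕ) : (values l σ).length = l.length := by
  induction l generalizing σ with
  | nil => rfl
  | cons I l ih => simp [values, ih]

theorem foldl_eq_append_values (l : List Instr) (σ : List ℕ) :
    l.foldl (fun σ I => σ ++ [I.eval σ]) σ = σ ++ values l σ := by
  induction l generalizing σ with
  | nil => simp [values]
  | cons I l ih => simp [values, ih]

theorem run_eq (p : Program) (v : List ℕ) :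
    p.run v = p.out.map fun i => (v ++ values p.code v).getD i 0 := by
  simp only [run, foldl_eq_append_values]

theorem values_append (l l' : List Instr) (σ : List ℕ) :
    values (l ++ l') σ = values l σ ++ values l' (σ ++ values l σ) := by
  induction l generalizing σ with
  | nil => simp [values]
  | cons I l ih => simp [values, ih]

/-- The renaming that places a program with `T` input registers behind `L` registers; its inputs
are found in the registers `g`. -/
def place (T L : ℕ) (g : ℕ → ℕ) (i : ℕ) : ℕ := if i < T then g i else L + (i - T)

theorem getD_append_place {σ τ w : List ℕ} {g : ℕ → ℕ}
    (h : ∀ i < τ.length, (σ ++ w).getD (g i) 0 = τ.getD i 0) (i : ℕ) :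
    (σ ++ w).getD (place τ.length σ.length g i) 0 = (τ ++ w).getD i 0 := by
  unfold place
  split_ifs with hi
  · rw [h i hi, List.getD_append _ _ _ _ hi]
  · rw [List.getD_append_right _ _ _ _ (Nat.le_add_right _ _),
      List.getD_append_right _ _ _ _ (not_lt.mp hi), Nat.add_sub_cancel_left]

theorem values_rename_place (l : List Instr) {σ τ : List ℕ} {g : ℕ → ℕ}
    (h : ∀ i < τ.length, ∀ w : List ℕ, w.length ≤ l.length →
      (σ ++ w).getD (g i) 0 = τ.getD i 0) :
    values (l.map (Instr.rename (place τ.length σ.length g))) σ = values l τ := by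
  suffices H : ∀ (l' : List Instr) (w : List ℕ), w.length + l'.length ≤ l.length →
      values (l'.map (Instr.rename (place τ.length σ.length g))) (σ ++ w) = values l' (τ ++ w) by
    simpa using H l [] (by simp)
  intro l'
  induction l' with
  | nil => intro w _; rfl
  | cons I l' ih =>
    intro w hw
    rw [List.length_cons] at hw
    have he : (I.rename (place τ.length σ.length g)).eval (σ ++ w) = I.eval (τ ++ w) :=
      Instr.eval_rename (getD_append_place fun i hi => h i hi w (by omega)) I
    simp only [List.map_cons, values, he, List.append_assoc]
    rw [ih (w ++ [I.eval (τ ++ w)]) (by simp; omega)]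

/-- A register number `i` that reads `0` if it is beyond `L`, made to do so beyond `K` as well. -/
def clip (L K i : ℕ) : ℕ := if i < L then i else K

theorem getD_append_clip {σ w : List ℕ} {K : ℕ} (hK : σ.length + w.length ≤ K) (i : ℕ) :
    (σ ++ w).getD (clip σ.length K i) 0 = σ.getD i 0 := by
  unfold clip
  split_ifs with hi
  · rw [List.getD_append _ _ _ _ hi]
  · rw [List.getD_eq_default _ _ (by simpa using hK), List.getD_eq_default _ _ (not_lt.mp hi)]

/-- Run `p` on `T` input registers, then `q` on the outputs of `p`. -/
def comp (T : ℕ) (p q : Program) : Program :=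
  let L := T + p.code.length
  let f := place p.out.length L fun i => clip L (L + q.code.length) (p.out.getD i 0)
  ⟨p.code ++ q.code.map (Instr.rename f), q.out.map f⟩

theorem run_comp {T : ℕ} (p q : Program) {v : List ℕ} (hv : v.length = T) :
    (comp T p q).run v = q.run (p.run v) := by
  have hL : (v ++ values p.code v).length = T + p.code.length := by simp [hv]
  have hT : (p.run v).length = p.out.length := by simp [run]
  have h : ∀ i < (p.run v).length, ∀ w : List ℕ, w.length ≤ q.code.length →
      ((v ++ values p.code v) ++ w).getD (clip (v ++ values p.code v).length
        ((v ++ values p.code v).length + q.code.length) (p.out.getD i 0)) 0 =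
        (p.run v).getD i 0 := by
    intro i hi w hw
    rw [getD_append_clip (by omega)]
    rw [hT] at hi
    rw [run_eq]
    simp [List.getD_eq_getElem?_getD, hi]
  have hval := values_rename_place q.code h
  rw [run_eq q, run_eq]
  simp only [comp, List.map_map, values_append]
  rw [← hL, ← hT, hval, ← List.append_assoc]
  refine List.map_congr_left fun i _ => ?_
  simp only [Function.comp_apply]
  exact getD_append_place (fun i hi => h i hi _ (by simp)) i

theorem size_comp (T : ℕ) (p q : Program) : (comp T p q).size ≤ p.size + q.size := by
  have h : ∀ f, (List.map (Instr.size ∘ Instr.rename f) q.code) = q.code.map Instr.size :=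
    fun f => List.map_congr_left fun I _ => Instr.size_rename f I
  simp only [comp, size, List.map_append, List.map_map, List.sum_append, List.length_map, h]
  omega

/-- Run `p` and `q` on the same `T` input registers and output both results. -/
def append (T : ℕ) (p q : Program) : Program :=
  let L := T + p.code.length
  let f := place T L id
  ⟨p.code ++ q.code.map (Instr.rename f), p.out.map (clip L (L + q.code.length)) ++ q.out.map f⟩

theorem run_append {T : ℕ} (p q : Program) {v : List ℕ} (hv : v.length = T) :
    (append T p q).run v = p.run v ++ q.run v := by
  have hL : (v ++ values p.code v).length = T + p.code.length := by simp [hv]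
  have h : ∀ i < v.length, ∀ w : List ℕ, w.length ≤ q.code.length →
      ((v ++ values p.code v) ++ w).getD (id i) 0 = v.getD i 0 := by
    intro i hi w _
    rw [List.append_assoc, id, List.getD_append _ _ _ _ hi]
  have hval := values_rename_place q.code h
  rw [run_eq q, run_eq, run_eq p]
  simp only [append, List.map_append, List.map_map, values_append]
  rw [← hL, ← hv, hval, ← List.append_assoc]
  congr 1
  · refine List.map_congr_left fun i _ => ?_
    simp only [Function.comp_apply]
    exact getD_append_clip (by simp) i
  · refine List.map_congr_left fun i _ => ?_
    simp only [Function.comp_apply]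
    exact getD_append_place (fun i hi => h i hi _ (by simp)) i

theorem size_append (T : ℕ) (p q : Program) : (append T p q).size ≤ p.size + q.size := by
  have h : ∀ f, (List.map (Instr.size ∘ Instr.rename f) q.code) = q.code.map Instr.size :=
    fun f => List.map_congr_left fun I _ => Instr.size_rename f I
  simp only [append, size, List.map_append, List.map_map, List.sum_append, List.length_map,
    List.length_append, h]
  omega

/-! ### The bit length of registers -/

theorem size_eval_le {I : Instr} {σ : List ℕ} {B : ℕ} (hσ : ∀ x ∈ σ, Nat.size x ≤ B)
    (hI : I.size ≤ B) : Nat.size (I.eval σ) ≤ B := by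
  have hget : ∀ i, Nat.size (σ.getD i 0) ≤ B := by
    intro i
    by_cases hi : i < σ.length
    · rw [List.getD_eq_getElem _ _ hi]
      exact hσ _ (List.getElem_mem hi)
    · rw [List.getD_eq_default _ _ (not_lt.mp hi)]
      simp
  have hmod : ∀ x M : ℕ, 1 + M.size ≤ B → Nat.size (x % (M + 1)) ≤ B := fun x M hM =>
    (Nat.size_le_size (Nat.lt_succ_iff.mp (Nat.mod_lt x M.succ_pos))).trans (by omega)
  cases I with
  | const c => exact le_trans (by simp [Instr.eval, Instr.size]) hI
  | add i j M => exact hmod _ _ hI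
  | mul i j M => exact hmod _ _ hI
  | div i j => exact (Nat.size_le_size (Nat.div_le_self _ _)).trans (hget i)
  | lt i j =>
    refine le_trans ?_ hI
    simp only [Instr.eval, Instr.size]
    split_ifs <;> simp

theorem size_values_le {l : List Instr} {σ : List ℕ} {B : ℕ} (hσ : ∀ x ∈ σ, Nat.size x ≤ B)
    (hl : ∀ I ∈ l, I.size ≤ B) : ∀ x ∈ values l σ, Nat.size x ≤ B := by
  induction l generalizing σ with
  | nil => simp [values]
  | cons I l ih =>
    have hI := size_eval_le hσ (hl I (by simp))
    intro x hx
    rw [values, List.mem_cons] at hx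
    rcases hx with rfl | hx
    · exact hI
    · refine ih (fun y hy => ?_) (fun J hJ => hl J (by simp [hJ])) x hx
      rcases List.mem_append.mp hy with hy | hy
      · exact hσ y hy
      · rw [List.mem_singleton.mp hy]
        exact hI

theorem size_run_le {p : Program} {v : List ℕ} {B : ℕ} (hv : ∀ x ∈ v, Nat.size x ≤ B)
    (hp : p.size ≤ B) : ∀ x ∈ p.run v, Nat.size x ≤ B := by
  have hval : ∀ x ∈ v ++ values p.code v, Nat.size x ≤ B := by
    intro x hx
    rcases List.mem_append.mp hx with hx | hx
    · exact hv x hx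
    · refine size_values_le hv (fun I hI => le_trans ?_ hp) x hx
      exact (List.single_le_sum (by simp) _ (List.mem_map_of_mem hI)).trans (Nat.le_add_right _ _)
  intro x hx
  rw [run_eq, List.mem_map] at hx
  obtain ⟨i, -, rfl⟩ := hx
  by_cases hi : i < (v ++ values p.code v).length
  · rw [List.getD_eq_getElem _ _ hi]
    exact hval _ (List.getElem_mem hi)
  · rw [List.getD_eq_default _ _ (not_lt.mp hi)]
    simp

end Program

/-! ### Functions that are computed by programs of a given size -/

/-- Some program of size at most `s` computes `f` from the encoding `e` of the argument. -/
def Computes {α : Type} (e f : α → List ℕ) (s : ℕ) : Prop :=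
  ∃ p : Program, p.size ≤ s ∧ ∀ a, p.run (e a) = f a

namespace Computes

variable {α : Type} {e f g : α → List ℕ} {s t T : ℕ}

theorem mono (h : Computes e f s) (hst : s ≤ t) : Computes e f t := by
  obtain ⟨p, hp, hr⟩ := h
  exact ⟨p, hp.trans hst, hr⟩

theorem congr (h : Computes e f s) (hfg : ∀ a, f a = g a) : Computes e g s := by
  obtain ⟨p, hp, hr⟩ := h
  exact ⟨p, hp, fun a => (hr a).trans (hfg a)⟩

theorem ofProgram (p : Program) (e : α → List ℕ) : Computes e (fun a => p.run (e a)) p.size :=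
  ⟨p, le_rfl, fun _ => rfl⟩

theorem append (he : ∀ a, (e a).length = T) (hf : Computes e f s) (hg : Computes e g t) :
    Computes e (fun a => f a ++ g a) (s + t) := by
  obtain ⟨p, hp, hpr⟩ := hf
  obtain ⟨q, hq, hqr⟩ := hg
  refine ⟨p.append T q, (Program.size_append _ _ _).trans (Nat.add_le_add hp hq), fun a => ?_⟩
  rw [Program.run_append p q (he a), hpr, hqr]

theorem comp (he : ∀ a, (e a).length = T) (hf : Computes e f s) (hg : Computes f g t) :
    Computes e g (s + t) := by
  obtain ⟨p, hp, hpr⟩ := hf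
  obtain ⟨q, hq, hqr⟩ := hg
  refine ⟨p.comp T q, (Program.size_comp _ _ _).trans (Nat.add_le_add hp hq), fun a => ?_⟩
  rw [Program.run_comp p q (he a), hpr, hqr]

/-- Precomposition with a map of the arguments. -/
theorem precomp {β : Type} (h : Computes e f s) (φ : β → α) :
    Computes (fun b => e (φ b)) (fun b => f (φ b)) s := by
  obtain ⟨p, hp, hpr⟩ := h
  exact ⟨p, hp, fun b => hpr (φ b)⟩

theorem nil (e : α → List ℕ) : Computes e (fun _ => []) 0 :=
  ⟨⟨[], []⟩, by simp [Program.size], fun a => rfl⟩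

/-- Reading one register. -/
theorem getD (e : α → List ℕ) (i : ℕ) : Computes e (fun a => [(e a).getD i 0]) 1 :=
  ⟨⟨[], [i]⟩, by simp [Program.size], fun a => rfl⟩

theorem self (he : ∀ a, (e a).length = T) : Computes e e T := by
  refine ⟨⟨[], List.range T⟩, by simp [Program.size], fun a => ?_⟩
  simp only [Program.run, List.foldl_nil]
  refine List.ext_getElem (by simp [he]) fun i h1 h2 => ?_
  simp [List.getElem_map, h2]

theorem instr (he : ∀ a, (e a).length = T) (I : Instr) :
    Computes e (fun a => [I.eval (e a)]) (I.size + 1) := by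
  refine ⟨⟨[I], [T]⟩, by simp [Program.size], fun a => ?_⟩
  simp [Program.run, ← he a]

theorem singleton (he : ∀ a, (e a).length = T) (c : ℕ) :
    Computes e (fun _ => [c]) (c.size + 2) :=
  (instr he (.const c)).mono (by simp [Instr.size]; omega)

theorem const (he : ∀ a, (e a).length = T) (c : List ℕ) :
    Computes e (fun _ => c) (bitLength c + c.length) := by
  induction c with
  | nil => exact (nil e).mono (Nat.zero_le _)
  | cons x c ih =>
    refine ((singleton he x).append he ih).mono ?_
    simp only [bitLength, List.map_cons, List.sum_cons, List.length_cons]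
    omega

theorem flatMap {ι : Type} (he : ∀ a, (e a).length = T) (l : List ι) {F : ι → α → List ℕ}
    (h : ∀ x ∈ l, Computes e (F x) s) :
    Computes e (fun a => l.flatMap fun x => F x a) (l.length * s) := by
  induction l with
  | nil => exact (nil e).mono (Nat.zero_le _)
  | cons x l ih =>
    refine ((h x (by simp)).append he (ih fun y hy => h y (by simp [hy]))).mono ?_
    rw [List.length_cons]
    linarith

theorem ofFn (he : ∀ a, (e a).length = T) {n : ℕ} {F : Fin n → α → ℕ}
    (h : ∀ i, Computes e (fun a => [F i a]) s) :
    Computes e (fun a => List.ofFn fun i => F i a) (n * s) := by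
  refine ((flatMap he (List.finRange n) fun i _ => h i).mono (by simp)).congr fun a => ?_
  rw [List.ofFn_eq_map]
  exact List.map_eq_flatMap.symm

theorem binary (he : ∀ a, (e a).length = T) {x y : α → ℕ} (hx : Computes e (fun a => [x a]) s)
    (hy : Computes e (fun a => [y a]) t) {I : Instr} {op : ℕ → ℕ → ℕ}
    (hI : ∀ a b, I.eval [a, b] = op a b) :
    Computes e (fun a => [op (x a) (y a)]) (s + t + (I.size + 1)) := by
  refine ((hx.append he hy).comp he (instr (T := 2) (fun _ => by simp) I)).congr fun a => ?_
  rw [← hI]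
  rfl

theorem addMod (he : ∀ a, (e a).length = T) {x y : α → ℕ} (hx : Computes e (fun a => [x a]) s)
    (hy : Computes e (fun a => [y a]) t) (M : ℕ) :
    Computes e (fun a => [(x a + y a) % (M + 1)]) (s + t + (M.size + 2)) :=
  (binary he hx hy (I := .add 0 1 M) (op := fun a b => (a + b) % (M + 1)) fun _ _ => rfl).mono
    (by simp only [Instr.size]; omega)

theorem mulMod (he : ∀ a, (e a).length = T) {x y : α → ℕ} (hx : Computes e (fun a => [x a]) s)
    (hy : Computes e (fun a => [y a]) t) (M : ℕ) :
    Computes e (fun a => [(x a * y a) % (M + 1)]) (s + t + (M.size + 2)) :=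
  (binary he hx hy (I := .mul 0 1 M) (op := fun a b => (a * b) % (M + 1)) fun _ _ => rfl).mono
    (by simp only [Instr.size]; omega)

theorem lt (he : ∀ a, (e a).length = T) {x y : α → ℕ} (hx : Computes e (fun a => [x a]) s)
    (hy : Computes e (fun a => [y a]) t) :
    Computes e (fun a => [if x a < y a then 1 else 0]) (s + t + 2) :=
  binary he hx hy (I := .lt 0 1) (op := fun a b => if a < b then 1 else 0) fun _ _ => rfl

/-! Tests: the output `[1]` stands for truth. -/

section Tests

open Classical in
/-- The output of a test. -/
noncomputable def testOutput (p : Prop) : List ℕ := [if p then 1 else 0]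

theorem testOutput_eq_one_iff {p : Prop} : testOutput p = [1] ↔ p := by
  unfold testOutput
  split_ifs with h <;> simp [h]

variable {p q : α → Prop}

theorem test_and (he : ∀ a, (e a).length = T) (hp : Computes e (fun a => testOutput (p a)) s)
    (hq : Computes e (fun a => testOutput (q a)) t) :
    Computes e (fun a => testOutput (p a ∧ q a)) (s + t + 3) := by
  refine ((mulMod he hp hq 1).congr fun a => ?_).mono (by simp)
  unfold testOutput
  by_cases h1 : p a <;> by_cases h2 : q a <;> simp [h1, h2]

theorem test_eq_const (he : ∀ a, (e a).length = T) {x : α → ℕ}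
    (hx : Computes e (fun a => [x a]) s) (c : ℕ) :
    Computes e (fun a => testOutput (x a = c)) (2 * (s + c.size + 4) + 13) := by
  have hc := singleton he c
  have hneg : ∀ {y : α → ℕ} {s}, Computes e (fun a => [y a]) s →
      Computes e (fun a => testOutput (y a < 1)) (s + 5) := fun hy =>
    ((lt he hy (singleton he 1)).mono (by simp)).congr fun a => by
      unfold testOutput; congr
  refine ((test_and he (hneg (lt he hx hc)) (hneg (lt he hc hx))).mono (by omega)).congr
    fun a => ?_
  congr 1
  rw [eq_iff_iff]
  split_ifs <;> omega

theorem test_eq_list (he : ∀ a, (e a).length = T) (hf : Computes e f s) {m : ℕ}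
    (hm : ∀ a, (f a).length = m) {c : List ℕ} (hc : c.length = m) {B : ℕ}
    (hB : ∀ x ∈ c, Nat.size x ≤ B) :
    Computes e (fun a => testOutput (f a = c)) (s + (m * (2 * (B + 5) + 16) + 3)) := by
  refine hf.comp he ?_
  have hone : ∀ i, Computes f (fun a => testOutput ((f a).getD i 0 = c.getD i 0))
      (2 * (B + 5) + 13) := by
    intro i
    refine (test_eq_const hm (getD f i) _).mono ?_
    have : Nat.size (c.getD i 0) ≤ B := by
      by_cases hi : i < c.length
      · rw [List.getD_eq_getElem _ _ hi]
        exact hB _ (List.getElem_mem hi)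
      · rw [List.getD_eq_default _ _ (not_lt.mp hi)]
        simp
    omega
  have hall : ∀ k, Computes f (fun a => testOutput (∀ i < k, (f a).getD i 0 = c.getD i 0))
      (k * (2 * (B + 5) + 16) + 3) := by
    intro k
    induction k with
    | zero =>
      refine ((singleton hm 1).mono (by simp)).congr fun a => ?_
      simp [testOutput]
    | succ k ih =>
      refine ((test_and hm ih (hone k)).mono (by ring_nf; omega)).congr fun a => ?_
      congr 1
      rw [eq_iff_iff]
      constructor
      · rintro ⟨h1, h2⟩ i hi
        rcases Nat.lt_succ_iff_lt_or_eq.mp hi with h | rfl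
        · exact h1 i h
        · exact h2
      · exact fun h => ⟨fun i hi => h i (by omega), h k (by omega)⟩
  refine (hall m).congr fun a => ?_
  congr 1
  rw [eq_iff_iff]
  constructor
  · intro h
    refine List.ext_getElem (by rw [hm, hc]) fun i h1 h2 => ?_
    have := h i (by rwa [hm] at h1)
    rwa [List.getD_eq_getElem _ _ h1, List.getD_eq_getElem _ _ h2] at this
  · rintro h i -
    rw [h]

end Tests

/-! Arithmetic in `ℤ_q`. -/

section ZMod

variable {q : ℕ} [NeZero q]

theorem zmodAdd (he : ∀ a, (e a).length = T) {x y : α → ZMod q}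
    (hx : Computes e (fun a => [(x a).val]) s) (hy : Computes e (fun a => [(y a).val]) t) :
    Computes e (fun a => [(x a + y a).val]) (s + t + (q.size + 2)) := by
  have hq : q - 1 + 1 = q := Nat.sub_add_cancel (NeZero.pos q)
  refine ((addMod he hx hy (q - 1)).congr fun a => ?_).mono
    (Nat.add_le_add_left (Nat.add_le_add_right (Nat.size_le_size (Nat.sub_le _ _)) _) _)
  rw [hq, ZMod.val_add]

theorem zmodMul (he : ∀ a, (e a).length = T) {x y : α → ZMod q}
    (hx : Computes e (fun a => [(x a).val]) s) (hy : Computes e (fun a => [(y a).val]) t) :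
    Computes e (fun a => [(x a * y a).val]) (s + t + (q.size + 2)) := by
  have hq : q - 1 + 1 = q := Nat.sub_add_cancel (NeZero.pos q)
  refine ((mulMod he hx hy (q - 1)).congr fun a => ?_).mono
    (Nat.add_le_add_left (Nat.add_le_add_right (Nat.size_le_size (Nat.sub_le _ _)) _) _)
  rw [hq, ZMod.val_mul]

theorem zmodConst (he : ∀ a, (e a).length = T) (c : ZMod q) :
    Computes e (fun _ => [c.val]) (q.size + 2) :=
  (singleton he c.val).mono (Nat.add_le_add_right (Nat.size_le_size (ZMod.val_lt c).le) _)

theorem zmodCast (he : ∀ a, (e a).length = T) {x : α → ℕ}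
    (hx : Computes e (fun a => [x a]) s) :
    Computes e (fun a => [(x a : ZMod q).val]) (s + 2 + (q.size + 2)) := by
  have hq : q - 1 + 1 = q := Nat.sub_add_cancel (NeZero.pos q)
  refine ((addMod he hx (singleton he 0) (q - 1)).congr fun a => ?_).mono ?_
  · rw [hq, ZMod.val_natCast, add_zero]
  · have := Nat.size_le_size (Nat.sub_le q 1)
    simp only [Nat.size_zero]
    omega

theorem zmodSum {ι : Type} (he : ∀ a, (e a).length = T) (S : Finset ι) {x : ι → α → ZMod q}
    (hx : ∀ i ∈ S, Computes e (fun a => [(x i a).val]) s) :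
    Computes e (fun a => [(∑ i ∈ S, x i a).val]) (S.card * (s + (q.size + 2)) + (q.size + 2)) := by
  classical
  induction S using Finset.induction_on with
  | empty => exact ((zmodConst he (0 : ZMod q)).congr fun a => by simp).mono (by simp)
  | insert i S hi ih =>
    refine ((zmodAdd he (hx i (by simp)) (ih fun j hj => hx j (by simp [hj]))).congr
      fun a => ?_).mono ?_
    · rw [Finset.sum_insert hi]
    · rw [Finset.card_insert_of_notMem hi]
      ring_nf
      omega

end ZMod

end Computes

/-! ### Programs as deterministic attackers -/

/-- A program as an attacker that tosses no coins. -/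
def Program.toAttacker (p : Program) : Attacker := ⟨0, p⟩

@[simp] theorem Program.size_toAttacker (p : Program) : p.toAttacker.size = p.size := by
  simp [toAttacker, Attacker.size]

/-- The attacker with fixed coins `r`. -/
def Attacker.runWith (A : Attacker) (r : Fin A.coins → Fin 2) (v : List ℕ) : List ℕ :=
  A.prog.run (List.ofFn (fun i => (r i : ℕ)) ++ v)

theorem Attacker.toReal_run_bind {δ : Type} (A : Attacker) (v : List ℕ) (k : List ℕ → PMF δ)
    (d : δ) :
    (((A.run v).bind k) d).toReal =
      expect (PMF.uniformOfFintype (Fin A.coins → Fin 2)) fun r => (k (A.runWith r v) d).toReal := by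
  rw [run, PMF.bind_map, toReal_bind_apply]
  rfl

theorem Attacker.acceptProb_run (A : Attacker) (v : List ℕ) :
    acceptProb (A.run v) = expect (PMF.uniformOfFintype (Fin A.coins → Fin 2)) fun r =>
      acceptProb (PMF.pure (A.runWith r v)) := by
  have h := A.toReal_run_bind v PMF.pure [1]
  rwa [PMF.bind_pure] at h

theorem Program.run_toAttacker (p : Program) (v : List ℕ) :
    p.toAttacker.run v = PMF.pure (p.run v) := by
  rw [toAttacker, Attacker.run]
  simp only [List.ofFn_zero, List.nil_append]
  exact PMF.map_const _ _

theorem Attacker.size_coins_le (A : Attacker) (r : Fin A.coins → Fin 2) :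
    ∀ x ∈ List.ofFn (fun i => (r i : ℕ)), Nat.size x ≤ 1 := by
  intro x hx
  obtain ⟨i, rfl⟩ := (List.mem_ofFn' _ _).mp hx
  exact (Nat.size_le_size (Nat.lt_succ_iff.mp (r i).isLt)).trans (by simp)

/-- Composing a program with `W` increases its size by at most `w`. -/
def Feasible (W : List ℕ → List ℕ) (w : ℕ) : Prop :=
  ∀ {α : Type} {e f : α → List ℕ} {T s : ℕ}, (∀ a, (e a).length = T) → Computes e f s →
    Computes e (fun a => W (f a)) (s + w)

theorem Attacker.feasible_runWith (A : Attacker) (r : Fin A.coins → Fin 2) :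
    Feasible (A.runWith r) (3 * A.size) := by
  intro α e f T s he hf
  have hc : Computes e (fun _ => List.ofFn fun i => (r i : ℕ)) (A.coins * 3) :=
    Computes.ofFn he (F := fun i _ => (r i : ℕ)) fun i =>
      (Computes.singleton he _).mono
        (Nat.add_le_add_right (A.size_coins_le r _ ((List.mem_ofFn' _ _).mpr ⟨i, rfl⟩)) 2)
  refine ((hc.append he hf).comp he (Computes.ofProgram A.prog _)).mono ?_
  simp only [Attacker.size]
  omega

theorem Computes.exists_length {α : Type} {e f : α → List ℕ} {s : ℕ} (h : Computes e f s) :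
    ∃ m, ∀ a, (f a).length = m := by
  obtain ⟨p, -, hp⟩ := h
  exact ⟨p.out.length, fun a => by rw [← hp a]; simp [Program.run]⟩

/-- Copying a segment of the registers. -/
theorem Computes.segment {α : Type} {e f pre post : α → List ℕ} {m n : ℕ}
    (he : ∀ a, e a = pre a ++ f a ++ post a) (hpre : ∀ a, (pre a).length = m)
    (hf : ∀ a, (f a).length = n) : Computes e f n := by
  refine ⟨⟨[], (List.range n).map (m + ·)⟩, by simp [Program.size], fun a => ?_⟩
  simp only [Program.run, List.foldl_nil, List.map_map]
  refine List.ext_getElem (by simp [hf]) fun i h1 h2 => ?_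
  have : m + i - (pre a).length = i := by rw [hpre]; omega
  simp only [List.getElem_map, List.getElem_range, Function.comp_apply]
  rw [he, List.append_assoc, List.getD_append_right _ _ _ _ (by rw [hpre]; omega), this,
    List.getD_append _ _ _ _ h2, List.getD_eq_getElem _ _ h2]

instance : Inhabited Program := ⟨⟨[], []⟩⟩

/-! ### Arithmetic of `R_q` in programs -/

section RingPrograms

variable {n q : ℕ}

@[simp] theorem Rq.length_words (x : Rq n q) : (Rq.words x).length = n := by
  simp [Rq.words]

theorem Rq.getD_words_append (x : Rq n q) (l : List ℕ) (i : Fin n) :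
    (Rq.words x ++ l).getD i 0 = (x i).val := by
  rw [List.getD_append _ _ _ _ (by simp), List.getD_eq_getElem _ _ (by simp)]
  simp [Rq.words]

theorem Rq.parse_append_words [NeZero q] (pre post : List ℕ) (x : Rq n q) :
    Rq.parse (pre ++ (Rq.words x ++ post)) pre.length = x := by
  funext i
  rw [Rq.parse, List.getD_append_right _ _ _ _ (Nat.le_add_right _ _), Nat.add_sub_cancel_left,
    Rq.getD_words_append, ZMod.natCast_zmod_val]

/-- A bound on the size of a program for one operation of `R_q`. -/
def opCost (n q : ℕ) : ℕ := n * ((n * n + n + 1) * (4 * q.size + 10))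

theorem mul_le_opCost {c : ℕ} (h : c ≤ 4 * q.size + 10) : n * c ≤ opCost n q := by
  refine Nat.mul_le_mul_left n (h.trans ?_)
  exact Nat.le_mul_of_pos_left _ (Nat.succ_pos _)

theorem le_opCost (n q : ℕ) : n ≤ opCost n q := by
  simpa using mul_le_opCost (n := n) (q := q) (c := 1) (by omega)

namespace Computes

variable {α : Type} {e : α → List ℕ} {s t T : ℕ} {x y : α → Rq n q}

theorem coeff {pre post : α → List ℕ} {m : ℕ} (hpre : ∀ a, (pre a).length = m)
    (he : ∀ a, e a = pre a ++ (Rq.words (x a) ++ post a)) (i : Fin n) :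
    Computes e (fun a => [(x a i).val]) 1 := by
  refine (getD e (m + i)).congr fun a => ?_
  rw [he, List.getD_append_right _ _ _ _ (by rw [hpre]; omega), hpre, Nat.add_sub_cancel_left,
    Rq.getD_words_append]

theorem coeff_fst (x y : α → Rq n q) (i : Fin n) :
    Computes (fun a => Rq.words (x a) ++ Rq.words (y a)) (fun a => [(x a i).val]) 1 :=
  coeff (pre := fun _ => []) (m := 0) (fun _ => rfl) (fun _ => rfl) i

theorem coeff_snd (x y : α → Rq n q) (i : Fin n) :
    Computes (fun a => Rq.words (x a) ++ Rq.words (y a)) (fun a => [(y a i).val]) 1 :=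
  coeff (pre := fun a => Rq.words (x a)) (m := n) (post := fun _ => []) (fun _ => by simp)
    (fun _ => by simp) i

theorem length_two (x y : α → Rq n q) (a : α) :
    (Rq.words (x a) ++ Rq.words (y a)).length = n + n := by simp

variable [NeZero q]

theorem rqConst (he : ∀ a, (e a).length = T) (c : Rq n q) :
    Computes e (fun _ => Rq.words c) (opCost n q) :=
  (ofFn he (F := fun i _ => (c i).val) fun i => zmodConst he (c i)).mono
    (mul_le_opCost (by omega))

theorem rqParse {pre v : α → List ℕ} {m : ℕ} (he : ∀ a, (e a).length = T)
    (hpre : ∀ a, (pre a).length = m) (hev : ∀ a, e a = pre a ++ v a) (start : ℕ) :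
    Computes e (fun a => Rq.words (Rq.parse (v a) start : Rq n q)) (opCost n q) := by
  have h : ∀ i : Fin n, Computes e (fun a => [(Rq.parse (v a) start i : ZMod q).val])
      (1 + 2 + (q.size + 2)) := by
    intro i
    refine (zmodCast he (getD e (m + (start + i)))).congr fun a => ?_
    rw [Rq.parse, hev, List.getD_append_right _ _ _ _ (by rw [hpre]; omega), hpre,
      Nat.add_sub_cancel_left]
  exact (ofFn he h).mono (mul_le_opCost (by omega))

theorem rqAdd (he : ∀ a, (e a).length = T) (hx : Computes e (fun a => Rq.words (x a)) s)
    (hy : Computes e (fun a => Rq.words (y a)) t) :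
    Computes e (fun a => Rq.words (x a + y a)) (s + t + opCost n q) := by
  refine ((hx.append he hy).comp he (ofFn (length_two x y) fun i =>
    zmodAdd (length_two x y) (coeff_fst x y i) (coeff_snd x y i))).mono ?_
  exact Nat.add_le_add_left (mul_le_opCost (by omega)) _

theorem rqNeg (he : ∀ a, (e a).length = T) (hx : Computes e (fun a => Rq.words (x a)) s) :
    Computes e (fun a => Rq.words (-x a)) (s + opCost n q) := by
  have hl : ∀ a, (Rq.words (x a)).length = n := fun a => Rq.length_words _
  have h : ∀ i : Fin n, Computes (fun a => Rq.words (x a)) (fun a => [((-x a) i).val])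
      (q.size + 2 + 1 + (q.size + 2)) := fun i =>
    (zmodMul hl (zmodConst hl (-1)) (coeff (x := x) (pre := fun _ => []) (post := fun _ => []) (m := 0)
      (fun _ => rfl) (fun _ => by simp) i)).congr fun a => by simp
  exact (hx.comp he (ofFn hl h)).mono (Nat.add_le_add_left (mul_le_opCost (by omega)) _)

theorem rqMul (he : ∀ a, (e a).length = T) (hx : Computes e (fun a => Rq.words (x a)) s)
    (hy : Computes e (fun a => Rq.words (y a)) t) :
    Computes e (fun a => Rq.words (Rq.mul (x a) (y a))) (s + t + opCost n q) := by
  have hl := length_two x y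
  have hterm : ∀ k i j : Fin n, Computes (fun a => Rq.words (x a) ++ Rq.words (y a))
      (fun a => [(if (i : ℕ) + j = k then x a i * y a j
        else if (i : ℕ) + j = k + n then -(x a i * y a j) else 0 : ZMod q).val])
      (3 * (q.size + 2) + 2) := by
    intro k i j
    have hprod := zmodMul hl (coeff_fst x y i) (coeff_snd x y j)
    split_ifs
    · exact hprod.mono (by omega)
    · exact ((zmodMul hl (zmodConst hl (-1)) hprod).congr fun a => by simp).mono (by omega)
    · exact (zmodConst hl 0).mono (by omega)
  refine ((hx.append he hy).comp he (ofFn hl fun k => zmodSum hl Finset.univ fun i _ =>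
    zmodSum hl Finset.univ fun j _ => hterm k i j)).mono ?_
  refine Nat.add_le_add_left (Nat.mul_le_mul_left n ?_) _
  rw [Finset.card_univ, Fintype.card_fin]
  nlinarith [Nat.zero_le (n * q.size), Nat.zero_le (n * n * q.size)]

theorem rqSum {ι : Type} (he : ∀ a, (e a).length = T) (S : Finset ι) {x : ι → α → Rq n q}
    (hx : ∀ i ∈ S, Computes e (fun a => Rq.words (x i a)) s) :
    Computes e (fun a => Rq.words (∑ i ∈ S, x i a)) (S.card * (s + opCost n q) + opCost n q) := by
  classical
  induction S using Finset.induction_on with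
  | empty => exact ((rqConst he (0 : Rq n q)).congr fun a => by simp).mono (by simp)
  | insert i S hi ih =>
    refine ((rqAdd he (hx i (by simp)) (ih fun j hj => hx j (by simp [hj]))).congr
      fun a => ?_).mono ?_
    · rw [Finset.sum_insert hi]
    · rw [Finset.card_insert_of_notMem hi]
      ring_nf
      omega

end Computes

end RingPrograms

theorem Rq.mul_neg_left {n q : ℕ} (x y : Rq n q) : Rq.mul (-x) y = -Rq.mul x y := by
  funext k
  simp only [Rq.mul, Pi.neg_apply, ← Finset.sum_neg_distrib]
  refine Finset.sum_congr rfl fun i _ => Finset.sum_congr rfl fun j _ => ?_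
  split_ifs <;> simp

namespace CKKS

variable {P : CKKS}

@[simp] theorem length_pairWords (c : P.Ring × P.Ring) :
    (pairWords c).length = P.degree + P.degree := by
  simp [pairWords, degree]

/-- A bound on the size of a program for one operation of the ring of `P`. -/
def cost (P : CKKS) : ℕ := opCost P.degree P.q

theorem degree_le_cost (P : CKKS) : P.degree ≤ P.cost := le_opCost _ _

section Programs

variable {α : Type} {e : α → List ℕ} {s t T : ℕ}

theorem computes_encrypt (he : ∀ a, (e a).length = T) {pk : α → P.Ring × P.Ring}
    {m : α → P.Ring} (hpk : Computes e (fun a => pairWords (pk a)) s)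
    (hm : Computes e (fun a => Rq.words (m a)) t) (ρ : P.Coins) :
    Computes e (fun a => pairWords (P.encrypt (pk a) (m a) ρ)) (2 * s + t + 11 * P.cost) := by
  have hl : ∀ a, (pairWords (pk a)).length = P.degree + P.degree := fun a => length_pairWords _
  have h1 : Computes e (fun a => Rq.words (pk a).1) (s + P.degree) :=
    hpk.comp he (Computes.segment (pre := fun _ => []) (post := fun a => Rq.words (pk a).2)
      (m := 0) (fun _ => by simp [pairWords]) (fun _ => rfl) fun _ => Rq.length_words _)
  have h2 : Computes e (fun a => Rq.words (pk a).2) (s + P.degree) :=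
    hpk.comp he (Computes.segment (pre := fun a => Rq.words (pk a).1) (post := fun a => [])
      (m := P.degree) (fun _ => by simp [pairWords]) (fun _ => Rq.length_words _)
      fun _ => Rq.length_words _)
  have hc := fun c : P.Ring => Computes.rqConst he c
  refine ((Computes.rqAdd he (Computes.rqAdd he (Computes.rqMul he h1 (hc ρ.1)) (hc ρ.2.1))
    hm).append he (Computes.rqAdd he (Computes.rqMul he h2 (hc ρ.1)) (hc ρ.2.2))).mono ?_
  have hd := P.degree_le_cost
  change _ + P.cost + P.cost + P.cost + P.cost + _ + P.cost + (_ + P.cost + P.cost + P.cost +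
    P.cost) ≤ _
  omega

end Programs

theorem expect_keyGen (f : (P.Ring × P.Ring) × P.Ring → ℝ) :
    expect P.keyGen f = expect P.χs fun s => expect P.χe fun e =>
      expect (PMF.uniformOfFintype P.Ring) fun a => f ((-(Rq.mul a s) + e, a), s) := by
  simp only [keyGen, expect_bind, expect_pure]

theorem expect_coinDist (f : P.Coins → ℝ) :
    expect P.coinDist f = expect P.χu fun u => expect P.χe fun e₁ => expect P.χe fun e₂ =>
      f (u, e₁, e₂) := by
  simp only [coinDist, expect_bind, expect_pure]

end CKKS

/-! ### Ring-LWE with sampled randomness -/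

section RLWE

variable {P : CKKS}

/-- The Ring-LWE advantage of a program. -/
noncomputable def rlweAdvantage (P : CKKS) (χ : PMF P.Ring) (k : ℕ) (p : Program) : ℝ :=
  |acceptProb ((rlweSamples P χ k).bind fun x => p.toAttacker.run (sampleWords x)) -
    acceptProb ((uniformSamples P k).bind fun x => p.toAttacker.run (sampleWords x))|

theorem RLWEHard.exists_bound {P : ℕ → CKKS} {χ : ∀ sec, PMF (P sec).Ring} {k : ℕ}
    (h : RLWEHard P χ k) {b : ℕ → ℕ} (hb : PolyBounded b) :
    ∃ ε : ℕ → ℝ, Negligible ε ∧ (∀ sec, 0 ≤ ε sec) ∧ ∀ sec (p : Program), p.size ≤ b sec →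
      rlweAdvantage (P sec) (χ sec) k p ≤ ε sec :=
  Negligible.exists_uniform_bound Program.size (fun sec p => rlweAdvantage (P sec) (χ sec) k p)
    (fun _ _ => abs_nonneg _) (fun _ _ => abs_acceptProb_sub_le_one _ _)
    (fun A hA => h (fun sec => (A sec).toAttacker) (by simpa [PolyTime] using hA)) hb

/-- The Ring-LWE bound for a function that is computed by a program. -/
theorem abs_expect_rlwe_sub_le {χ : PMF P.Ring} {k b : ℕ} {ε : ℝ}
    (h : ∀ p : Program, p.size ≤ b → rlweAdvantage P χ k p ≤ ε)
    {f : (Fin k → P.Ring × P.Ring) → List ℕ} (hf : Computes sampleWords f b) :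
    |expect (rlweSamples P χ k) (fun x => acceptProb (PMF.pure (f x))) -
      expect (uniformSamples P k) (fun x => acceptProb (PMF.pure (f x)))| ≤ ε := by
  obtain ⟨p, hp, hr⟩ := hf
  simpa only [rlweAdvantage, acceptProb_bind, Program.run_toAttacker, hr] using h p hp

theorem sampleWords_one (x : Fin 1 → P.Ring × P.Ring) :
    sampleWords x = CKKS.pairWords (x 0) := by
  simp [sampleWords, List.finRange_succ]

theorem sampleWords_two (x : Fin 2 → P.Ring × P.Ring) :
    sampleWords x = CKKS.pairWords (x 0) ++ CKKS.pairWords (x 1) := by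
  simp [sampleWords, List.finRange_succ]

theorem expect_rlweSamples_one (χ : PMF P.Ring) (f : (Fin 1 → P.Ring × P.Ring) → ℝ) :
    expect (rlweSamples P χ 1) f = expect χ fun s => expect (PMF.uniformOfFintype P.Ring) fun a =>
      expect P.χe fun e => f fun _ => (a, Rq.mul a s + e) := by
  simp only [rlweSamples, expect_bind, expect_iidFamily_one, expect_pure]

theorem expect_rlweSamples_two (χ : PMF P.Ring) (f : (Fin 2 → P.Ring × P.Ring) → ℝ) :
    expect (rlweSamples P χ 2) f = expect χ fun s =>
      expect (PMF.uniformOfFintype P.Ring) fun a => expect P.χe fun e =>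
        expect (PMF.uniformOfFintype P.Ring) fun a' => expect P.χe fun e' =>
          f ![(a, Rq.mul a s + e), (a', Rq.mul a' s + e')] := by
  simp only [rlweSamples, expect_bind, expect_iidFamily_two, expect_pure]

theorem expect_uniformSamples_one (f : (Fin 1 → P.Ring × P.Ring) → ℝ) :
    expect (uniformSamples P 1) f = expect (PMF.uniformOfFintype P.Ring) fun a =>
      expect (PMF.uniformOfFintype P.Ring) fun b => f fun _ => (a, b) := by
  rw [← expect_uniform_prod (fun z : P.Ring × P.Ring => f fun _ => z),
    ← expect_uniform_equiv (Equiv.funUnique (Fin 1) (P.Ring × P.Ring))]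
  refine congrArg _ (funext fun x => congrArg f (funext fun i => ?_))
  rw [Subsingleton.elim i default]
  rfl

theorem expect_uniformSamples_two (f : (Fin 2 → P.Ring × P.Ring) → ℝ) :
    expect (uniformSamples P 2) f = expect (PMF.uniformOfFintype P.Ring) fun a =>
      expect (PMF.uniformOfFintype P.Ring) fun b => expect (PMF.uniformOfFintype P.Ring) fun a' =>
        expect (PMF.uniformOfFintype P.Ring) fun b' => f ![(a, b), (a', b')] := by
  have h : ∀ z : P.Ring × P.Ring, (expect (PMF.uniformOfFintype P.Ring) fun a' =>
      expect (PMF.uniformOfFintype P.Ring) fun b' => f ![z, (a', b')]) =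
      expect (PMF.uniformOfFintype (P.Ring × P.Ring)) fun z' => f ![z, z'] := fun z =>
    (expect_uniform_prod fun z' => f ![z, z']).symm
  simp only [h]
  rw [← expect_uniform_prod (fun z : P.Ring × P.Ring =>
      expect (PMF.uniformOfFintype (P.Ring × P.Ring)) fun z' => f ![z, z']),
    ← expect_uniform_prod (fun w : (P.Ring × P.Ring) × (P.Ring × P.Ring) => f ![w.1, w.2]),
    ← expect_uniform_equiv (finTwoArrowEquiv (P.Ring × P.Ring))]
  refine congrArg _ (funext fun x => congrArg f (funext fun i => ?_))
  fin_cases i <;> rfl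

end RLWE

/-! ### IND-CPA security of CKKS from Ring-LWE -/

section INDCPA

variable {P : CKKS}

/-- The message that the challenge bit selects from the output of the first attacker. -/
def challengeMessage (P : CKKS) (β : Bool) (v : List ℕ) : P.Ring :=
  if β then Rq.parse v P.degree else Rq.parse v 0

/-- Acceptance in the IND-CPA game with deterministic attackers: `V` computes the messages and
the state, `W` is the second attacker. -/
noncomputable def cpaAccept (V : P.Ring × P.Ring → List ℕ) (W : List ℕ → List ℕ)
    (pk c : P.Ring × P.Ring) : ℝ :=
  acceptProb (PMF.pure (W (CKKS.pairWords pk ++ CKKS.pairWords c ++ V pk)))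

/-- The IND-CPA game with deterministic attackers. -/
noncomputable def cpaGame (V : P.Ring × P.Ring → List ℕ) (W : List ℕ → List ℕ) (β : Bool) : ℝ :=
  expect P.keyGen fun keys => expect P.coinDist fun ρ =>
    cpaAccept V W keys.1 (P.encrypt keys.1 (challengeMessage P β (V keys.1)) ρ)

theorem acceptProb_indCPAExp (A₁ A₂ : Attacker) (β : Bool) :
    acceptProb (indCPAExp P A₁ A₂ β) =
      expect (PMF.uniformOfFintype (Fin A₁.coins → Fin 2)) fun r₁ =>
        expect (PMF.uniformOfFintype (Fin A₂.coins → Fin 2)) fun r₂ =>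
          cpaGame (P := P) (fun pk => A₁.runWith r₁ (CKKS.pairWords pk)) (A₂.runWith r₂) β := by
  have h : acceptProb (indCPAExp P A₁ A₂ β) = expect P.keyGen fun keys =>
      expect (PMF.uniformOfFintype (Fin A₁.coins → Fin 2)) fun r₁ =>
        expect P.coinDist fun ρ => expect (PMF.uniformOfFintype (Fin A₂.coins → Fin 2)) fun r₂ =>
          cpaAccept (fun pk => A₁.runWith r₁ (CKKS.pairWords pk)) (A₂.runWith r₂) keys.1
            (P.encrypt keys.1 (challengeMessage P β
              (A₁.runWith r₁ (CKKS.pairWords keys.1))) ρ) := by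
    rw [indCPAExp, acceptProb_bind]
    refine congrArg _ (funext fun keys => ?_)
    rw [acceptProb, Attacker.toReal_run_bind]
    refine congrArg _ (funext fun r₁ => ?_)
    rw [← acceptProb, acceptProb_bind]
    refine congrArg _ (funext fun ρ => ?_)
    rw [Attacker.acceptProb_run]
    rfl
  rw [h, expect_comm]
  refine congrArg _ (funext fun r₁ => ?_)
  simp only [cpaGame]
  rw [expect_comm (PMF.uniformOfFintype (Fin A₂.coins → Fin 2))]
  refine congrArg _ (funext fun keys => ?_)
  rw [expect_comm]

/-- The size of the reduction from Ring-LWE to IND-CPA for attackers of sizes `s` and `t`. -/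
def reductionCost (P : CKKS) (s t : ℕ) : ℕ := 40 * P.cost + 4 * s + 3 * t

section Reduction

variable {V : P.Ring × P.Ring → List ℕ} {W : List ℕ → List ℕ} {s t : ℕ}

theorem computes_challenge {α : Type} {e : α → List ℕ} {T s₀ : ℕ} (he : ∀ a, (e a).length = T)
    (pk : α → P.Ring × P.Ring) (hpk : Computes e (fun a => CKKS.pairWords (pk a)) s₀)
    (hV : Computes CKKS.pairWords V s) (β : Bool) :
    Computes e (fun a => Rq.words (challengeMessage P β (V (pk a)))) (s₀ + s + P.cost) := by
  obtain ⟨m, hm⟩ := hV.exists_length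
  have hp : ∀ start, Computes (fun a => V (pk a))
      (fun a => Rq.words (Rq.parse (V (pk a)) start : P.Ring)) P.cost := fun start =>
    Computes.rqParse (pre := fun _ => []) (v := fun a => V (pk a)) (m := 0)
      (fun a => hm (pk a)) (fun _ => rfl) (fun _ => rfl) start
  refine (hpk.comp he (hV.precomp pk)).comp he ?_
  unfold challengeMessage
  cases β
  · exact hp 0
  · exact hp P.degree

/-- Public keys are pseudorandom under Ring-LWE with secrets from `χs`. -/
theorem abs_cpaGame_sub_uniformKey_le {b : ℕ} {ε : ℝ}
    (h : ∀ p : Program, p.size ≤ b → rlweAdvantage P P.χs 1 p ≤ ε)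
    (hV : Computes CKKS.pairWords V s)
    (hW : Feasible W (3 * t))
    (hb : reductionCost P s t ≤ b) (β : Bool) :
    |cpaGame V W β - (expect (PMF.uniformOfFintype P.Ring) fun a =>
      expect (PMF.uniformOfFintype P.Ring) fun b => expect P.coinDist fun ρ =>
        cpaAccept V W (b, a) (P.encrypt (b, a) (challengeMessage P β (V (b, a))) ρ))| ≤ ε := by
  set g : P.Coins → P.Ring → P.Ring → ℝ := fun ρ a b =>
    cpaAccept V W (b, a) (P.encrypt (b, a) (challengeMessage P β (V (b, a))) ρ) with hg
  have e1 : cpaGame V W β = expect P.coinDist fun ρ => expect P.χs fun s =>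
      expect (PMF.uniformOfFintype P.Ring) fun a => expect P.χe fun e =>
        g ρ (-a) (Rq.mul a s + e) := by
    rw [cpaGame, expect_comm]
    refine congrArg _ (funext fun ρ => ?_)
    rw [CKKS.expect_keyGen]
    refine congrArg _ (funext fun s => ?_)
    rw [expect_comm, ← expect_uniform_equiv (Equiv.neg P.Ring)]
    simp only [Equiv.neg_apply, Rq.mul_neg_left, neg_neg, hg]
  have e2 : (expect (PMF.uniformOfFintype P.Ring) fun a =>
      expect (PMF.uniformOfFintype P.Ring) fun b => expect P.coinDist fun ρ => g ρ a b) =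
      expect P.coinDist fun ρ => expect (PMF.uniformOfFintype P.Ring) fun a =>
        expect (PMF.uniformOfFintype P.Ring) fun b => g ρ (-a) b := by
    have hc : ∀ F : P.Ring → P.Coins → ℝ,
        (expect (PMF.uniformOfFintype P.Ring) fun y => expect P.coinDist fun ρ => F y ρ) =
          expect P.coinDist fun ρ => expect (PMF.uniformOfFintype P.Ring) fun y => F y ρ :=
      fun F => expect_comm _ _ _
    simp only [hc]
    refine congrArg _ (funext fun ρ => ?_)
    exact (expect_uniform_equiv (Equiv.neg P.Ring) fun a =>
      expect (PMF.uniformOfFintype P.Ring) fun b => g ρ a b).symm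
  rw [e1, e2]
  refine abs_expect_sub_le _ fun ρ => ?_
  set pk : (Fin 1 → P.Ring × P.Ring) → P.Ring × P.Ring := fun x => ((x 0).2, -(x 0).1) with hpkdef
  have he : ∀ x : Fin 1 → P.Ring × P.Ring, (sampleWords x).length = P.degree + P.degree := by
    intro x
    rw [sampleWords_one, CKKS.length_pairWords]
  have hpk : Computes sampleWords (fun x => CKKS.pairWords (pk x)) (3 * P.cost) := by
    have h1 : Computes sampleWords (fun x : Fin 1 → P.Ring × P.Ring => Rq.words (x 0).1)
        P.degree :=
      Computes.segment (pre := fun _ => []) (post := fun x => Rq.words (x 0).2) (m := 0)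
        (fun x => by simp [sampleWords_one, CKKS.pairWords]) (fun _ => rfl)
        fun _ => Rq.length_words _
    have h2 : Computes sampleWords (fun x : Fin 1 → P.Ring × P.Ring => Rq.words (x 0).2)
        P.degree :=
      Computes.segment (pre := fun x => Rq.words (x 0).1) (post := fun _ => []) (m := P.degree)
        (fun x => by simp [sampleWords_one, CKKS.pairWords]; rfl) (fun _ => Rq.length_words _)
        fun _ => Rq.length_words _
    refine (h2.append he (Computes.rqNeg he h1)).mono ?_
    have := P.degree_le_cost
    change _ + (_ + P.cost) ≤ _
    omega
  have hm := computes_challenge he pk hpk hV β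
  have hin := (hpk.append he (CKKS.computes_encrypt he hpk hm ρ)).append he
    (hpk.comp he (hV.precomp pk))
  have hD := (hW he hin).mono (t := b) (by
    refine le_trans ?_ hb
    unfold reductionCost
    omega)
  have := abs_expect_rlwe_sub_le h hD
  rw [expect_rlweSamples_one, expect_uniformSamples_one] at this
  exact this

/-- Under Ring-LWE with secrets from `χu`, encryptions under a uniformly random public key are
pseudorandom, and therefore independent of the message. -/
theorem abs_uniformKey_sub_uniform_le {b : ℕ} {ε : ℝ}
    (h : ∀ p : Program, p.size ≤ b → rlweAdvantage P P.χu 2 p ≤ ε)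
    (hV : Computes CKKS.pairWords V s)
    (hW : Feasible W (3 * t))
    (hb : reductionCost P s t ≤ b) (β : Bool) :
    |(expect (PMF.uniformOfFintype P.Ring) fun a =>
      expect (PMF.uniformOfFintype P.Ring) fun b => expect P.coinDist fun ρ =>
        cpaAccept V W (b, a) (P.encrypt (b, a) (challengeMessage P β (V (b, a))) ρ)) -
      (expect (PMF.uniformOfFintype P.Ring) fun b => expect (PMF.uniformOfFintype P.Ring) fun a =>
        expect (PMF.uniformOfFintype P.Ring) fun c => expect (PMF.uniformOfFintype P.Ring) fun d =>
          cpaAccept V W (b, a) (c, d))| ≤ ε := by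
  set pk : (Fin 2 → P.Ring × P.Ring) → P.Ring × P.Ring := fun x => ((x 0).1, (x 1).1) with hpkdef
  set ct : (Fin 2 → P.Ring × P.Ring) → P.Ring × P.Ring := fun x =>
    ((x 0).2 + challengeMessage P β (V (pk x)), (x 1).2) with hct
  have he : ∀ x : Fin 2 → P.Ring × P.Ring, (sampleWords x).length =
      P.degree + P.degree + (P.degree + P.degree) := by
    intro x
    rw [sampleWords_two, List.length_append, CKKS.length_pairWords, CKKS.length_pairWords]
  have h01 : Computes sampleWords (fun x : Fin 2 → P.Ring × P.Ring => Rq.words (x 0).1)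
      P.degree :=
    Computes.segment (pre := fun _ => [])
      (post := fun x => Rq.words (x 0).2 ++ CKKS.pairWords (x 1)) (m := 0)
      (fun x => by simp [sampleWords_two, CKKS.pairWords]) (fun _ => rfl)
      fun _ => Rq.length_words _
  have h02 : Computes sampleWords (fun x : Fin 2 → P.Ring × P.Ring => Rq.words (x 0).2)
      P.degree :=
    Computes.segment (pre := fun x => Rq.words (x 0).1)
      (post := fun x => CKKS.pairWords (x 1)) (m := P.degree)
      (fun x => by simp [sampleWords_two, CKKS.pairWords]; rfl) (fun _ => Rq.length_words _)
      fun _ => Rq.length_words _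
  have h11 : Computes sampleWords (fun x : Fin 2 → P.Ring × P.Ring => Rq.words (x 1).1)
      P.degree :=
    Computes.segment (pre := fun x => CKKS.pairWords (x 0))
      (post := fun x => Rq.words (x 1).2) (m := P.degree + P.degree)
      (fun x => by simp [sampleWords_two, CKKS.pairWords]) (fun _ => CKKS.length_pairWords _)
      fun _ => Rq.length_words _
  have h12 : Computes sampleWords (fun x : Fin 2 → P.Ring × P.Ring => Rq.words (x 1).2)
      P.degree :=
    Computes.segment (pre := fun x => CKKS.pairWords (x 0) ++ Rq.words (x 1).1)
      (post := fun x => []) (m := P.degree + P.degree + P.degree)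
      (fun x => by simp [sampleWords_two, CKKS.pairWords])
      (fun _ => by rw [List.length_append, CKKS.length_pairWords, Rq.length_words]; rfl)
      fun _ => Rq.length_words _
  have hpk : Computes sampleWords (fun x => CKKS.pairWords (pk x)) (P.degree + P.degree) :=
    h01.append he h11
  have hm := computes_challenge he pk hpk hV β
  have hc : Computes sampleWords (fun x => CKKS.pairWords (ct x)) _ :=
    (Computes.rqAdd he h02 hm).append he h12
  have hin := (hpk.append he hc).append he (hpk.comp he (hV.precomp pk))
  have hD := (hW he hin).mono (t := b) (by
    refine le_trans ?_ hb
    have := P.degree_le_cost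
    change _ + (_ + P.cost + _) + _ + _ ≤ _
    unfold reductionCost
    omega)
  have key := abs_expect_rlwe_sub_le h hD
  have e1 : expect (rlweSamples P P.χu 2) (fun x => acceptProb (PMF.pure
      (W (CKKS.pairWords (pk x) ++ CKKS.pairWords (ct x) ++ V (pk x))))) =
      expect (PMF.uniformOfFintype P.Ring) fun a =>
      expect (PMF.uniformOfFintype P.Ring) fun b => expect P.coinDist fun ρ =>
        cpaAccept V W (b, a) (P.encrypt (b, a) (challengeMessage P β (V (b, a))) ρ) := by
    simp only [expect_rlweSamples_two, CKKS.expect_coinDist]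
    rw [expect_comm (PMF.uniformOfFintype P.Ring)]
    simp only [← expect_comm P.χu]
    refine congrArg _ (funext fun u => congrArg _ (funext fun b => ?_))
    rw [expect_comm]
    refine congrArg _ (funext fun a => congrArg _ (funext fun e₁ => congrArg _
      (funext fun e₂ => ?_)))
    rfl
  have e2 : expect (uniformSamples P 2) (fun x => acceptProb (PMF.pure
      (W (CKKS.pairWords (pk x) ++ CKKS.pairWords (ct x) ++ V (pk x))))) =
      expect (PMF.uniformOfFintype P.Ring) fun b => expect (PMF.uniformOfFintype P.Ring) fun a =>
        expect (PMF.uniformOfFintype P.Ring) fun c => expect (PMF.uniformOfFintype P.Ring) fun d =>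
          cpaAccept V W (b, a) (c, d) := by
    rw [expect_uniformSamples_two]
    refine congrArg _ (funext fun b => ?_)
    rw [expect_comm]
    refine congrArg _ (funext fun a => ?_)
    exact expect_uniform_equiv (Equiv.addRight (challengeMessage P β (V (b, a)))) fun c =>
      expect (PMF.uniformOfFintype P.Ring) fun d => cpaAccept V W (b, a) (c, d)
  rwa [e1, e2] at key

end Reduction

theorem PolyBounded.cost {P : ℕ → CKKS} (hdegree : PolyBounded fun sec => (P sec).degree)
    (hq : PolyBounded fun sec => (P sec).q.size) : PolyBounded fun sec => (P sec).cost :=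
  hdegree.mul ((((hdegree.mul hdegree).add hdegree).add (PolyBounded.const 1)).mul
    (((PolyBounded.const 4).mul hq).add (PolyBounded.const 10)))

theorem INDCPASecure.of_rlweHard {P : ℕ → CKKS} (hdegree : PolyBounded fun sec => (P sec).degree)
    (hq : PolyBounded fun sec => (P sec).q.size)
    (h₁ : RLWEHard P (fun sec => (P sec).χs) 1) (h₂ : RLWEHard P (fun sec => (P sec).χu) 2) :
    INDCPASecure P := by
  intro A₁ A₂ hA₁ hA₂
  have hb : PolyBounded fun sec => reductionCost (P sec)
      (3 * (A₁ sec).size + ((P sec).degree + (P sec).degree)) (A₂ sec).size :=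
    (((PolyBounded.const 40).mul (PolyBounded.cost hdegree hq)).add ((PolyBounded.const 4).mul
      (((PolyBounded.const 3).mul hA₁).add (hdegree.add hdegree)))).add
        ((PolyBounded.const 3).mul hA₂)
  obtain ⟨ε₁, hε₁, -, hb₁⟩ := h₁.exists_bound hb
  obtain ⟨ε₂, hε₂, -, hb₂⟩ := h₂.exists_bound hb
  have hε : Negligible fun sec => 2 * (ε₁ sec + ε₂ sec) := (hε₁.add hε₂).const_mul 2
  refine hε.of_abs_le fun sec => ?_
  rw [abs_abs]
  refine le_trans ?_ (le_abs_self _)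
  rw [acceptProb_indCPAExp, acceptProb_indCPAExp]
  refine abs_expect_sub_le _ fun r₁ => abs_expect_sub_le _ fun r₂ => ?_
  have hV : Computes CKKS.pairWords (fun pk : (P sec).Ring × (P sec).Ring =>
      (A₁ sec).runWith r₁ (CKKS.pairWords pk))
      (3 * (A₁ sec).size + ((P sec).degree + (P sec).degree)) :=
    ((A₁ sec).feasible_runWith r₁ CKKS.length_pairWords
      (Computes.self CKKS.length_pairWords)).mono
      (by omega)
  have hW : Feasible ((A₂ sec).runWith r₂) (3 * (A₂ sec).size) := (A₂ sec).feasible_runWith r₂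
  have k1 := fun β => abs_cpaGame_sub_uniformKey_le (hb₁ sec) hV hW le_rfl β
  have k2 := fun β => abs_uniformKey_sub_uniform_le (hb₂ sec) hV hW le_rfl β
  have t1 := abs_le.mp (k1 true)
  have t2 := abs_le.mp (k2 true)
  have f1 := abs_le.mp (k1 false)
  have f2 := abs_le.mp (k2 false)
  rw [abs_le]
  constructor <;> linarith [t1.1, t1.2, t2.1, t2.2, f1.1, f1.2, f2.1, f2.2]

end INDCPA

/-! ### Concrete bounds from IND-CPA security -/

section CPABound

/-- The IND-CPA advantage of a pair of programs. -/
noncomputable def cpaAdvantage (P : CKKS) (p : Program × Program) : ℝ :=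
  |acceptProb (indCPAExp P p.1.toAttacker p.2.toAttacker true) -
    acceptProb (indCPAExp P p.1.toAttacker p.2.toAttacker false)|

theorem INDCPASecure.exists_bound {P : ℕ → CKKS} (h : INDCPASecure P) {b : ℕ → ℕ}
    (hb : PolyBounded b) :
    ∃ ε : ℕ → ℝ, Negligible ε ∧ (∀ sec, 0 ≤ ε sec) ∧
      ∀ sec (p : Program × Program), p.1.size + p.2.size ≤ b sec →
        cpaAdvantage (P sec) p ≤ ε sec :=
  Negligible.exists_uniform_bound (fun p : Program × Program => p.1.size + p.2.size)
    (fun sec p => cpaAdvantage (P sec) p) (fun _ _ => abs_nonneg _)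
    (fun _ _ => abs_acceptProb_sub_le_one _ _)
    (fun A hA => h (fun sec => (A sec).1.toAttacker) (fun sec => (A sec).2.toAttacker)
      (hA.of_le fun sec => by simp) (hA.of_le fun sec => by simp)) hb

variable {P : CKKS}

theorem acceptProb_indCPAExp_program (p : Program × Program) (β : Bool) :
    acceptProb (indCPAExp P p.1.toAttacker p.2.toAttacker β) =
      cpaGame (P := P) (fun pk => p.1.run (CKKS.pairWords pk)) p.2.run β := by
  have h : ∀ (p : Program) (r : Fin p.toAttacker.coins → Fin 2), p.toAttacker.runWith r = p.run :=
    fun p r => rfl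
  rw [acceptProb_indCPAExp]
  simp only [h, expect_const]

/-- The state that consists of two messages. -/
def messageWords (m₀ m₁ : P.Ring) : List ℕ := Rq.words m₀ ++ Rq.words m₁

theorem challengeMessage_messageWords (m₀ m₁ : P.Ring) (β : Bool) :
    challengeMessage P β (messageWords m₀ m₁) = if β then m₁ else m₀ := by
  unfold challengeMessage messageWords
  have h0 : Rq.parse (Rq.words m₀ ++ Rq.words m₁) 0 = m₀ :=
    Rq.parse_append_words [] (Rq.words m₁) m₀
  have h1 : Rq.parse (Rq.words m₀ ++ Rq.words m₁) P.degree = m₁ := by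
    have := Rq.parse_append_words (Rq.words m₀) [] m₁
    rwa [List.append_nil, Rq.length_words] at this
  rw [h0, h1]

/-- Encryptions of two fixed messages are indistinguishable. -/
theorem abs_expect_encrypt_sub_le {b s : ℕ} {ε : ℝ}
    (h : ∀ p : Program × Program, p.1.size + p.2.size ≤ b → cpaAdvantage P p ≤ ε)
    (m₀ m₁ : P.Ring) {f : P.Ring × P.Ring → P.Ring × P.Ring → List ℕ}
    (hf : Computes (fun x : (P.Ring × P.Ring) × (P.Ring × P.Ring) =>
      CKKS.pairWords x.1 ++ CKKS.pairWords x.2 ++ messageWords m₀ m₁) (fun x => f x.1 x.2) s)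
    (hb : 2 * P.cost + s ≤ b) :
    |(expect P.keyGen fun keys => expect P.coinDist fun ρ =>
        acceptProb (PMF.pure (f keys.1 (P.encrypt keys.1 m₁ ρ)))) -
      (expect P.keyGen fun keys => expect P.coinDist fun ρ =>
        acceptProb (PMF.pure (f keys.1 (P.encrypt keys.1 m₀ ρ))))| ≤ ε := by
  obtain ⟨p₂, hp₂, hr₂⟩ := hf
  have hmsg : Computes (CKKS.pairWords (P := P)) (fun _ => messageWords m₀ m₁)
      (P.cost + P.cost) :=
    (Computes.rqConst CKKS.length_pairWords m₀).append CKKS.length_pairWords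
      (Computes.rqConst CKKS.length_pairWords m₁)
  obtain ⟨p₁, hp₁, hr₁⟩ := hmsg
  have key := h (p₁, p₂) (by dsimp only; omega)
  rw [cpaAdvantage, acceptProb_indCPAExp_program, acceptProb_indCPAExp_program] at key
  simp only [cpaGame, cpaAccept, hr₁,
    challengeMessage_messageWords, if_true, Bool.false_eq_true, if_false] at key
  have hr : ∀ pk c : P.Ring × P.Ring,
      p₂.run (CKKS.pairWords pk ++ CKKS.pairWords c ++ messageWords m₀ m₁) = f pk c :=
    fun pk c => hr₂ (pk, c)
  simpa only [hr] using key

end CPABound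

/-! ### The view of the adversary -/

namespace FedShield

variable {F : FedShield} {P : CKKS}

/-- The words of a view in terms of the leakage `ℓ` and the ciphertexts `c`. -/
def viewWords (F : FedShield) (P : CKKS) (C : Finset (Fin F.clients)) (dec : Bool)
    (ℓ : (F.Index P → P.Ring) × (Fin F.rounds → Fin (numBlocks P F.d F.k) → P.Ring))
    (c : F.Index P → P.Ring × P.Ring) (pk : P.Ring × P.Ring) (ρ : F.Index P → P.Coins) :
    List ℕ :=
  CKKS.pairWords pk ++ (List.finRange F.rounds).flatMap fun t =>
    ((List.finRange F.clients).flatMap fun i =>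
      if i ∈ F.participants t then
        (List.finRange (numBlocks P F.d F.k)).flatMap fun j =>
          CKKS.pairWords (c (t, i, j)) ++
            if i ∈ C then
              Rq.words (ℓ.1 (t, i, j)) ++ Rq.words (ρ (t, i, j)).1 ++
                Rq.words (ρ (t, i, j)).2.1 ++ Rq.words (ρ (t, i, j)).2.2
            else []
      else []) ++
    (List.finRange (numBlocks P F.d F.k)).flatMap fun j =>
      CKKS.pairWords (∑ i ∈ F.participants t, c (t, i, j)) ++
        if dec then Rq.words (ℓ.2 t j) else []

/-- The ciphertexts of the messages `M`. -/
def ciphertexts (M : F.Index P → P.Ring) (pk : P.Ring × P.Ring) (ρ : F.Index P → P.Coins) :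
    F.Index P → P.Ring × P.Ring := fun x => P.encrypt pk (M x) (ρ x)

/-- All plaintexts of a run. -/
noncomputable def messages (P : CKKS) (U : F.Updates) : F.Index P → P.Ring :=
  fun x => F.plaintext P U x.1 x.2.1 x.2.2

theorem view_eq (C : Finset (Fin F.clients)) (dec : Bool) (U : F.Updates) :
    F.view P C dec U = P.keyGen.bind fun keys => (iidFamily (F.Index P) P.coinDist).map fun ρ =>
      viewWords F P C dec (F.leakage P C dec U) (ciphertexts (messages P U) keys.1 ρ)
        keys.1 ρ := by
  rw [view]
  refine congrArg _ (funext fun keys => congrArg (fun f => PMF.map f _) (funext fun ρ => ?_))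
  rw [viewWords]
  congr 1
  refine List.flatMap_congr fun t _ => ?_
  rw [roundView]
  congr 1
  · refine List.flatMap_congr fun i _ => ?_
    by_cases hi : i ∈ F.participants t
    · rw [if_pos hi, if_pos hi]
      refine List.flatMap_congr fun j _ => ?_
      by_cases hC : i ∈ C
      · simp only [hC, if_true, leakage, Finset.mem_inter, hi, and_self]
        rfl
      · simp only [hC, if_false]
        rfl
    · rw [if_neg hi, if_neg hi]
  · refine List.flatMap_congr fun j _ => ?_
    cases dec <;> rfl

theorem messages_eq_of_leakage_eq {C : Finset (Fin F.clients)} {dec : Bool} {U U' : F.Updates}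
    (h : F.leakage P C dec U = F.leakage P C dec U') {x : F.Index P}
    (hx : x.2.1 ∈ C ∩ F.participants x.1) : messages P U x = messages P U' x := by
  have := congrFun (congrArg Prod.fst h) x
  simpa only [leakage, hx, if_true, messages] using this

theorem viewWords_congr_coins (C : Finset (Fin F.clients)) (dec : Bool)
    (ℓ : (F.Index P → P.Ring) × (Fin F.rounds → Fin (numBlocks P F.d F.k) → P.Ring))
    (c : F.Index P → P.Ring × P.Ring) (pk : P.Ring × P.Ring) {ρ ρ' : F.Index P → P.Coins}
    (h : ∀ x, x.2.1 ∈ C ∩ F.participants x.1 → ρ x = ρ' x) :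
    viewWords F P C dec ℓ c pk ρ = viewWords F P C dec ℓ c pk ρ' := by
  unfold viewWords
  congr 1
  refine List.flatMap_congr fun t _ => ?_
  congr 1
  refine List.flatMap_congr fun i _ => ?_
  split_ifs with hi hC
  · refine List.flatMap_congr fun j _ => ?_
    rw [h (t, i, j) (Finset.mem_inter.mpr ⟨hC, hi⟩)]
  · rfl
  · rfl

theorem lt_of_mem_viewWords {C : Finset (Fin F.clients)} {dec : Bool}
    {ℓ : (F.Index P → P.Ring) × (Fin F.rounds → Fin (numBlocks P F.d F.k) → P.Ring)}
    {c : F.Index P → P.Ring × P.Ring} {pk : P.Ring × P.Ring} {ρ : F.Index P → P.Coins} :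
    ∀ w ∈ viewWords F P C dec ℓ c pk ρ, w < P.q := by
  have hw : ∀ (x : P.Ring), ∀ w ∈ Rq.words x, w < P.q := by
    intro x w hw
    obtain ⟨i, rfl⟩ := (List.mem_ofFn' _ _).mp hw
    exact ZMod.val_lt _
  have hp : ∀ (x : P.Ring × P.Ring), ∀ w ∈ CKKS.pairWords x, w < P.q := fun x w h =>
    (List.mem_append.mp h).elim (hw _ w) (hw _ w)
  intro w h
  simp only [viewWords, List.mem_append, List.mem_flatMap] at h
  rcases h with h | ⟨t, -, ⟨i, -, h⟩ | ⟨j, -, h | h⟩⟩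
  · exact hp _ w h
  · split_ifs at h with h1 h2
    · simp only [List.mem_flatMap, List.mem_append] at h
      obtain ⟨j, -, h | ((h | h) | h) | h⟩ := h
      · exact hp _ w h
      all_goals exact hw _ w h
    · simp only [List.mem_flatMap, List.append_nil] at h
      obtain ⟨j, -, h⟩ := h
      exact hp _ w h
    · simp at h
  · exact hp _ w h
  · split_ifs at h
    · exact hw _ w h
    · simp at h

/-- A bound on the size of a program that computes a view from a public key and a ciphertext. -/
def viewCost (F : FedShield) (P : CKKS) : ℕ :=
  2 * P.cost + F.rounds * (F.clients * (numBlocks P F.d F.k * (20 * P.cost)) +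
    numBlocks P F.d F.k * (2 * (F.clients * (18 * P.cost) + P.cost) + P.cost))

/-- The view in which the ciphertext with index `x₀` is given, and all other encryptions use the
messages `M` and the coins `ρ`. -/
theorem computes_viewWords (C : Finset (Fin F.clients)) (dec : Bool)
    (ℓ : (F.Index P → P.Ring) × (Fin F.rounds → Fin (numBlocks P F.d F.k) → P.Ring))
    (M : F.Index P → P.Ring) (ρ : F.Index P → P.Coins) (x₀ : F.Index P) (m₀ m₁ : P.Ring) :
    Computes (fun x : (P.Ring × P.Ring) × (P.Ring × P.Ring) =>
        CKKS.pairWords x.1 ++ CKKS.pairWords x.2 ++ messageWords m₀ m₁)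
      (fun x => viewWords F P C dec ℓ (Function.update (ciphertexts M x.1 ρ) x₀ x.2) x.1 ρ)
      (viewCost F P) := by
  set e : (P.Ring × P.Ring) × (P.Ring × P.Ring) → List ℕ := fun x =>
    CKKS.pairWords x.1 ++ CKKS.pairWords x.2 ++ messageWords m₀ m₁ with hedef
  set c : (P.Ring × P.Ring) × (P.Ring × P.Ring) → F.Index P → P.Ring × P.Ring := fun x =>
    Function.update (ciphertexts M x.1 ρ) x₀ x.2 with hcdef
  have hd := P.degree_le_cost
  have he : ∀ a, (e a).length =
      P.degree + P.degree + (P.degree + P.degree) + (messageWords m₀ m₁).length := by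
    intro a
    simp only [hedef, List.length_append, CKKS.length_pairWords]
  have hpk : Computes e (fun a => CKKS.pairWords a.1) (P.degree + P.degree) :=
    Computes.segment (pre := fun _ => [])
      (post := fun a => CKKS.pairWords a.2 ++ messageWords m₀ m₁) (m := 0)
      (fun a => by simp [hedef]) (fun _ => rfl) fun _ => CKKS.length_pairWords _
  have hconst : ∀ z : P.Ring, Computes e (fun _ => Rq.words z) P.cost := fun z =>
    Computes.rqConst he z
  have hc : ∀ x, Computes e (fun a => CKKS.pairWords (c a x)) (16 * P.cost) := by
    intro x
    by_cases hx : x = x₀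
    · subst hx
      simp only [hcdef, Function.update_self]
      exact (Computes.segment (e := e) (f := fun a => CKKS.pairWords a.2)
        (pre := fun a => CKKS.pairWords a.1)
        (post := fun a => messageWords m₀ m₁) (m := P.degree + P.degree)
        (fun a => rfl) (fun _ => CKKS.length_pairWords _)
        fun _ => CKKS.length_pairWords _).mono (by omega)
    · simp only [hcdef, Function.update_of_ne hx]
      exact (CKKS.computes_encrypt he hpk (hconst (M x)) (ρ x)).mono (by omega)
  have hc1 : ∀ x, Computes e (fun a => Rq.words (c a x).1) (17 * P.cost) := fun x =>
    ((hc x).comp he (Computes.segment (pre := fun _ => []) (post := fun a => Rq.words (c a x).2)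
      (m := 0) (fun _ => by simp [CKKS.pairWords]) (fun _ => rfl)
      fun _ => Rq.length_words _)).mono (by change _ + P.degree ≤ _; omega)
  have hc2 : ∀ x, Computes e (fun a => Rq.words (c a x).2) (17 * P.cost) := fun x =>
    ((hc x).comp he (Computes.segment (pre := fun a => Rq.words (c a x).1) (post := fun _ => [])
      (m := P.degree) (fun _ => by simp [CKKS.pairWords]) (fun _ => Rq.length_words _)
      fun _ => Rq.length_words _)).mono (by change _ + P.degree ≤ _; omega)
  have hentry : ∀ t i j, Computes e (fun a => CKKS.pairWords (c a (t, i, j)) ++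
      if i ∈ C then
        Rq.words (ℓ.1 (t, i, j)) ++ Rq.words (ρ (t, i, j)).1 ++
          Rq.words (ρ (t, i, j)).2.1 ++ Rq.words (ρ (t, i, j)).2.2
      else []) (20 * P.cost) := by
    intro t i j
    by_cases hC : i ∈ C
    · simp only [hC, if_true]
      exact ((hc _).append he ((((hconst _).append he (hconst _)).append he (hconst _)).append he
        (hconst _))).mono (by omega)
    · simp only [hC, if_false]
      exact ((hc _).append he (Computes.nil e)).mono (by omega)
  have hsum : ∀ t j, Computes e (fun a =>
      CKKS.pairWords (∑ i ∈ F.participants t, c a (t, i, j)) ++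
        if dec then Rq.words (ℓ.2 t j) else [])
      (2 * (F.clients * (18 * P.cost) + P.cost) + P.cost) := by
    intro t j
    have hcard : (F.participants t).card ≤ F.clients :=
      (Finset.card_le_univ _).trans_eq (Fintype.card_fin _)
    have hmono := Nat.mul_le_mul_right (18 * P.cost) hcard
    have h1 : Computes e (fun a => Rq.words (∑ i ∈ F.participants t, c a (t, i, j)).1)
        (F.clients * (18 * P.cost) + P.cost) := by
      refine ((Computes.rqSum he (F.participants t) fun i _ => hc1 (t, i, j)).congr
        fun a => ?_).mono ?_
      · rw [Prod.fst_sum]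
      · change _ * (_ + P.cost) + P.cost ≤ _
        rw [show 17 * P.cost + P.cost = 18 * P.cost by ring]
        omega
    have h2 : Computes e (fun a => Rq.words (∑ i ∈ F.participants t, c a (t, i, j)).2)
        (F.clients * (18 * P.cost) + P.cost) := by
      refine ((Computes.rqSum he (F.participants t) fun i _ => hc2 (t, i, j)).congr
        fun a => ?_).mono ?_
      · rw [Prod.snd_sum]
      · change _ * (_ + P.cost) + P.cost ≤ _
        rw [show 17 * P.cost + P.cost = 18 * P.cost by ring]
        omega
    cases dec
    · exact ((h1.append he h2).append he (Computes.nil e)).mono (by omega)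
    · exact ((h1.append he h2).append he (hconst _)).mono (by omega)
  have hround : ∀ t, Computes e (fun a =>
      ((List.finRange F.clients).flatMap fun i =>
        if i ∈ F.participants t then
          (List.finRange (numBlocks P F.d F.k)).flatMap fun j =>
            CKKS.pairWords (c a (t, i, j)) ++
              if i ∈ C then
                Rq.words (ℓ.1 (t, i, j)) ++ Rq.words (ρ (t, i, j)).1 ++
                  Rq.words (ρ (t, i, j)).2.1 ++ Rq.words (ρ (t, i, j)).2.2
              else []
        else []) ++
      (List.finRange (numBlocks P F.d F.k)).flatMap fun j =>
        CKKS.pairWords (∑ i ∈ F.participants t, c a (t, i, j)) ++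
          if dec then Rq.words (ℓ.2 t j) else [])
      (F.clients * (numBlocks P F.d F.k * (20 * P.cost)) +
        numBlocks P F.d F.k * (2 * (F.clients * (18 * P.cost) + P.cost) + P.cost)) := by
    intro t
    refine Computes.append he ((Computes.flatMap he _ (s := numBlocks P F.d F.k * (20 * P.cost))
      fun i _ => ?_).mono (by rw [List.length_finRange])) ((Computes.flatMap he _ fun j _ =>
        hsum t j).mono (by rw [List.length_finRange]))
    by_cases hi : i ∈ F.participants t
    · simp only [hi, if_true]
      exact (Computes.flatMap he _ fun j _ => hentry t i j).mono (by rw [List.length_finRange])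
    · simp only [hi, if_false]
      exact (Computes.nil e).mono (Nat.zero_le _)
  refine (hpk.append he (Computes.flatMap he _ fun t _ => hround t)).mono ?_
  rw [List.length_finRange]
  exact Nat.add_le_add_right (by omega) _

/-! ### The hybrid argument -/

/-- The probability that `W` accepts a view in which the messages `M` are encrypted. -/
noncomputable def viewAccept (F : FedShield) (P : CKKS) (C : Finset (Fin F.clients)) (dec : Bool)
    (ℓ : (F.Index P → P.Ring) × (Fin F.rounds → Fin (numBlocks P F.d F.k) → P.Ring))
    (M : F.Index P → P.Ring) (W : List ℕ → List ℕ) : ℝ :=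
  expect P.keyGen fun keys => expect (iidFamily (F.Index P) P.coinDist) fun ρ =>
    acceptProb (PMF.pure (W (viewWords F P C dec ℓ (ciphertexts M keys.1 ρ) keys.1 ρ)))

section Hybrid

variable {C : Finset (Fin F.clients)} {dec : Bool}
  {ℓ : (F.Index P → P.Ring) × (Fin F.rounds → Fin (numBlocks P F.d F.k) → P.Ring)}
  {W : List ℕ → List ℕ} {w b : ℕ} {ε : ℝ}

theorem viewAccept_eq_of_not_mem {x₀ : F.Index P} (hx₀ : x₀.2.1 ∉ C ∩ F.participants x₀.1)
    (M : F.Index P → P.Ring) :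
    viewAccept F P C dec ℓ M W = expect (iidFamily (F.Index P) P.coinDist) fun ρ =>
      expect P.keyGen fun keys => expect P.coinDist fun c =>
        acceptProb (PMF.pure (W (viewWords F P C dec ℓ (Function.update
          (ciphertexts M keys.1 ρ) x₀ (P.encrypt keys.1 (M x₀) c)) keys.1 ρ))) := by
  rw [viewAccept, expect_comm, expect_iidFamily_update _ x₀]
  refine congrArg _ (funext fun ρ => ?_)
  rw [expect_comm]
  refine congrArg _ (funext fun keys => congrArg _ (funext fun c => ?_))
  have hct : ciphertexts M keys.1 (Function.update ρ x₀ c) =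
      Function.update (ciphertexts M keys.1 ρ) x₀ (P.encrypt keys.1 (M x₀) c) := by
    funext x
    by_cases hx : x = x₀
    · subst hx
      simp [ciphertexts]
    · simp [ciphertexts, hx]
  rw [hct, viewWords_congr_coins C dec ℓ _ keys.1 (ρ' := ρ)]
  intro x hx
  refine Function.update_of_ne ?_ _ _
  rintro rfl
  exact hx₀ hx

theorem abs_viewAccept_update_sub_le
    (h : ∀ p : Program × Program, p.1.size + p.2.size ≤ b → cpaAdvantage P p ≤ ε)
    (hW : Feasible W w) (hb : 2 * P.cost + (viewCost F P + w) ≤ b)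
    {x₀ : F.Index P} (hx₀ : x₀.2.1 ∉ C ∩ F.participants x₀.1) (M : F.Index P → P.Ring)
    (m : P.Ring) :
    |viewAccept F P C dec ℓ M W - viewAccept F P C dec ℓ (Function.update M x₀ m) W| ≤ ε := by
  rw [viewAccept_eq_of_not_mem hx₀, viewAccept_eq_of_not_mem hx₀]
  refine abs_expect_sub_le _ fun ρ => ?_
  have hct : ∀ pk (z : P.Ring × P.Ring),
      Function.update (ciphertexts (Function.update M x₀ m) pk ρ) x₀ z =
        Function.update (ciphertexts M pk ρ) x₀ z := by
    intro pk z
    funext x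
    by_cases hx : x = x₀
    · subst hx
      simp
    · simp [ciphertexts, hx]
  simp only [hct, Function.update_self]
  refine abs_expect_encrypt_sub_le h m (M x₀) (f := fun pk c =>
    W (viewWords F P C dec ℓ (Function.update (ciphertexts M pk ρ) x₀ c) pk ρ)) ?_ hb
  refine hW (T := P.degree + P.degree + (P.degree + P.degree) + (messageWords m (M x₀)).length)
    (fun a => ?_) (computes_viewWords C dec ℓ M ρ x₀ m (M x₀))
  simp only [List.length_append, CKKS.length_pairWords]

theorem abs_viewAccept_sub_le
    (h : ∀ p : Program × Program, p.1.size + p.2.size ≤ b → cpaAdvantage P p ≤ ε) (hε : 0 ≤ ε)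
    (hW : Feasible W w) (hb : 2 * P.cost + (viewCost F P + w) ≤ b) (M M' : F.Index P → P.Ring)
    (hM : ∀ x, x.2.1 ∈ C ∩ F.participants x.1 → M x = M' x) :
    |viewAccept F P C dec ℓ M W - viewAccept F P C dec ℓ M' W| ≤
      (F.rounds * (F.clients * numBlocks P F.d F.k) : ℕ) * ε := by
  classical
  have key : ∀ S : Finset (F.Index P),
      |viewAccept F P C dec ℓ M W -
        viewAccept F P C dec ℓ (fun x => if x ∈ S then M' x else M x) W| ≤ S.card * ε := by
    intro S
    induction S using Finset.induction_on with
    | empty => simp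
    | insert x₀ S hx ih =>
      have hupd : (fun x => if x ∈ insert x₀ S then M' x else M x) =
          Function.update (fun x => if x ∈ S then M' x else M x) x₀ (M' x₀) := by
        funext x
        by_cases hxx : x = x₀
        · subst hxx
          simp
        · simp [hxx]
      rw [hupd, Finset.card_insert_of_notMem hx]
      push_cast
      by_cases hx₀ : x₀.2.1 ∈ C ∩ F.participants x₀.1
      · rw [Function.update_eq_self_iff.mpr (by simp [hx, hM x₀ hx₀])]
        linarith
      · have h1 := abs_viewAccept_update_sub_le (ℓ := ℓ) (dec := dec) h hW hb hx₀
          (fun x => if x ∈ S then M' x else M x) (M' x₀)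
        refine (abs_sub_le _ _ _).trans ((add_le_add ih h1).trans_eq (by ring))
  have huniv := key Finset.univ
  simp only [Finset.mem_univ, if_true, Finset.card_univ, Fintype.card_prod, Fintype.card_fin]
    at huniv
  exact huniv

end Hybrid

theorem numBlocks_le (P : CKKS) (d k : ℕ) : numBlocks P d k ≤ d * k := by
  have hs : 0 < P.slots := Nat.two_pow_pos _
  unfold numBlocks
  rcases Nat.eq_zero_or_pos (d * k) with h | h
  · rw [h, Nat.div_eq_of_lt (by omega)]
  · refine Nat.div_le_of_le_mul ?_
    obtain ⟨x, hx⟩ := Nat.exists_eq_add_of_lt h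
    obtain ⟨y, hy⟩ := Nat.exists_eq_add_of_lt hs
    rw [hx, hy]
    ring_nf
    omega

/-- Under IND-CPA security, views with the same leakage are indistinguishable, with one negligible
bound for all updates and all tests of a given polynomial size. -/
theorem exists_view_bound {P : ℕ → CKKS} {F : ℕ → FedShield} (hcpa : INDCPASecure P)
    (hdegree : PolyBounded fun sec => (P sec).degree)
    (hq : PolyBounded fun sec => (P sec).q.size)
    (hclients : PolyBounded fun sec => (F sec).clients)
    (hrounds : PolyBounded fun sec => (F sec).rounds)
    (hd : PolyBounded fun sec => (F sec).d)
    (hk : PolyBounded fun sec => (F sec).k) {w : ℕ → ℕ} (hw : PolyBounded w) :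
    ∃ ε : ℕ → ℝ, Negligible ε ∧ (∀ sec, 0 ≤ ε sec) ∧
      ∀ sec (C : Finset (Fin (F sec).clients)) (dec : Bool) (U U' : (F sec).Updates),
        (F sec).leakage (P sec) C dec U = (F sec).leakage (P sec) C dec U' →
        ∀ W : List ℕ → List ℕ, Feasible W (w sec) →
          |viewAccept (F sec) (P sec) C dec ((F sec).leakage (P sec) C dec U)
              (messages (P sec) U) W -
            viewAccept (F sec) (P sec) C dec ((F sec).leakage (P sec) C dec U')
              (messages (P sec) U') W| ≤ ε sec := by
  have hB : PolyBounded fun sec => numBlocks (P sec) (F sec).d (F sec).k :=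
    (hd.mul hk).of_le fun sec => numBlocks_le _ _ _
  have hcost := PolyBounded.cost hdegree hq
  have hmulcost := fun c : ℕ => (PolyBounded.const c).mul hcost
  have hview : PolyBounded fun sec => viewCost (F sec) (P sec) :=
    (hmulcost 2).add (hrounds.mul ((hclients.mul (hB.mul (hmulcost 20))).add
      (hB.mul (((PolyBounded.const 2).mul ((hclients.mul (hmulcost 18)).add hcost)).add hcost))))
  obtain ⟨ε, hε, hε0, hbound⟩ := hcpa.exists_bound ((hmulcost 2).add (hview.add hw))
  refine ⟨_, hε.polyBounded_mul (hrounds.mul (hclients.mul hB)),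
    fun sec => mul_nonneg (Nat.cast_nonneg _) (hε0 sec), fun sec C dec U U' hU W hW => ?_⟩
  rw [← hU]
  exact abs_viewAccept_sub_le (hbound sec) (hε0 sec) hW le_rfl _ _
    fun x hx => messages_eq_of_leakage_eq hU hx

theorem acceptProb_view_bind (C : Finset (Fin F.clients)) (dec : Bool) (U : F.Updates)
    (A : Attacker) :
    acceptProb ((F.view P C dec U).bind A.run) =
      expect (PMF.uniformOfFintype (Fin A.coins → Fin 2)) fun r =>
        viewAccept F P C dec (F.leakage P C dec U) (messages P U) (A.runWith r) := by
  rw [view_eq, PMF.bind_bind, acceptProb_bind]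
  simp only [PMF.bind_map, acceptProb_bind, Function.comp_apply, Attacker.acceptProb_run,
    viewAccept]
  rw [expect_comm (PMF.uniformOfFintype (Fin A.coins → Fin 2))]
  refine congrArg _ (funext fun keys => ?_)
  rw [expect_comm]

end FedShield

/-! ### Inference attacks -/

theorem PMF.bind_apply_le {α β : Type} (μ : PMF α) (k : α → PMF β) (b : β) {c : ENNReal}
    (h : ∀ a, k a b ≤ c) : μ.bind k b ≤ c := by
  rw [PMF.bind_apply]
  calc ∑' a, μ a * k a b ≤ ∑' a, μ a * c := ENNReal.tsum_le_tsum fun a => by gcongr; exact h a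
    _ = c := by rw [ENNReal.tsum_mul_right, μ.tsum_coe, one_mul]

theorem PMF.bind_apply_le_bind_apply_add {α β : Type} (μ : PMF α) (k k' : α → PMF β) (b : β)
    {c : ENNReal} (h : ∀ a, k a b ≤ k' a b + c) : μ.bind k b ≤ μ.bind k' b + c := by
  rw [PMF.bind_apply, PMF.bind_apply]
  calc ∑' a, μ a * k a b ≤ ∑' a, (μ a * k' a b + μ a * c) :=
        ENNReal.tsum_le_tsum fun a => by rw [← mul_add]; gcongr; exact h a
    _ = _ := by rw [ENNReal.tsum_add, ENNReal.tsum_mul_right, μ.tsum_coe, one_mul]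

theorem size_le_bitLength {v : List ℕ} : ∀ x ∈ v, Nat.size x ≤ bitLength v := fun x hx =>
  (Nat.le_succ _).trans (List.single_le_sum (by simp) _ (List.mem_map_of_mem hx))

theorem length_le_bitLength (v : List ℕ) : v.length ≤ bitLength v := by
  induction v with
  | nil => simp
  | cons x v ih =>
    simp only [bitLength, List.map_cons, List.sum_cons, List.length_cons] at ih ⊢
    omega

/-- The test whether the attacker with coins `r` and side information `v` outputs `t`. -/
noncomputable def Attacker.guessTest (A : Attacker) (r : Fin A.coins → Fin 2) (v t : List ℕ)
    (l : List ℕ) : List ℕ := Computes.testOutput (A.runWith r (l ++ v) = t)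

/-- A bound on the size of a program for the test of a guess. -/
def guessCost (a s B : ℕ) : ℕ := 2 * a + 3 * s + (s * (2 * (B + 5) + 16) + 3)

theorem Attacker.feasible_guessTest (A : Attacker) (r : Fin A.coins → Fin 2) {v t : List ℕ}
    {a B : ℕ} (hv : bitLength v ≤ a) (ht : t.length = A.prog.out.length)
    (hB : ∀ x ∈ t, Nat.size x ≤ B) : Feasible (A.guessTest r v t) (guessCost a A.size B) := by
  intro α e f T s he hf
  have h1 := A.feasible_runWith r he (hf.append he (Computes.const he v))
  have hm : ∀ x, (A.runWith r (f x ++ v)).length = A.prog.out.length := fun x => by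
    simp [runWith, Program.run]
  refine (Computes.test_eq_list he h1 hm ht hB).mono ?_
  have hout : A.prog.out.length ≤ A.size := by
    simp only [size, Program.size]
    omega
  have hmul := Nat.mul_le_mul_right (2 * (B + 5) + 16) hout
  have hlen := length_le_bitLength v
  unfold guessCost
  omega

namespace FedShield

variable {F : FedShield} {P : CKKS} {C : Finset (Fin F.clients)} {dec : Bool}

theorem toReal_guess_apply (U : F.Updates) (A : Attacker) (v t : List ℕ) :
    (((F.view P C dec U).bind fun w => (A.run (w ++ v)).map fun y => decide (y = t)) true).toReal =
      expect (PMF.uniformOfFintype (Fin A.coins → Fin 2)) fun r =>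
        viewAccept F P C dec (F.leakage P C dec U) (messages P U) (A.guessTest r v t) := by
  have htest : ∀ p : Prop, ∀ [Decidable p], (PMF.pure (decide p) true).toReal =
      acceptProb (PMF.pure (Computes.testOutput p)) := by
    intro p _
    rw [acceptProb_pure, PMF.pure_apply]
    by_cases hp : p <;> simp [hp, Computes.testOutput_eq_one_iff]
  simp only [← PMF.bind_pure_comp]
  rw [view_eq, PMF.bind_bind, toReal_bind_apply]
  simp only [PMF.bind_map, toReal_bind_apply, Function.comp_apply, Attacker.toReal_run_bind,
    viewAccept, htest, Attacker.guessTest]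
  rw [expect_comm (PMF.uniformOfFintype (Fin A.coins → Fin 2))]
  refine congrArg _ (funext fun keys => ?_)
  rw [expect_comm]

theorem viewAccept_nonneg
    (ℓ : (F.Index P → P.Ring) × (Fin F.rounds → Fin (numBlocks P F.d F.k) → P.Ring))
    (M : F.Index P → P.Ring) (W : List ℕ → List ℕ) : 0 ≤ viewAccept F P C dec ℓ M W :=
  Finset.sum_nonneg fun _ _ => mul_nonneg ENNReal.toReal_nonneg
    (Finset.sum_nonneg fun _ _ => mul_nonneg ENNReal.toReal_nonneg (acceptProb_nonneg _))

/-- Indistinguishability of views carries over to the tests of guesses of arbitrary targets. -/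
theorem viewAccept_guessTest_le {a : ℕ} {ε : ℝ} (hε : 0 ≤ ε) {U U' : F.Updates} (A : Attacker)
    (h : ∀ W, Feasible W (guessCost a A.size (A.size + P.q.size + a + 1)) →
      |viewAccept F P C dec (F.leakage P C dec U) (messages P U) W -
        viewAccept F P C dec (F.leakage P C dec U') (messages P U') W| ≤ ε)
    (r : Fin A.coins → Fin 2) {v : List ℕ} (hv : bitLength v ≤ a) (t : List ℕ) :
    viewAccept F P C dec (F.leakage P C dec U) (messages P U) (A.guessTest r v t) ≤
      viewAccept F P C dec (F.leakage P C dec U') (messages P U') (A.guessTest r v t) + ε := by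
  by_cases ht : t.length = A.prog.out.length ∧ ∀ x ∈ t, Nat.size x ≤ A.size + P.q.size + a + 1
  · have := abs_le.mp (h _ (A.feasible_guessTest r hv ht.1 ht.2))
    linarith [this.2]
  · have hfalse : ∀ c pk ρ, A.runWith r
        (viewWords F P C dec (F.leakage P C dec U) c pk ρ ++ v) ≠ t := by
      rintro c pk ρ rfl
      refine ht ⟨by simp [Attacker.runWith, Program.run], ?_⟩
      refine Program.size_run_le (fun x hx => ?_) (by simp only [Attacker.size]; omega)
      rcases List.mem_append.mp hx with hx | hx
      · have := A.size_coins_le r x hx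
        omega
      rcases List.mem_append.mp hx with hx | hx
      · have := Nat.size_le_size (lt_of_mem_viewWords x hx).le
        omega
      · have := size_le_bitLength x hx
        omega
    have hzero : viewAccept F P C dec (F.leakage P C dec U) (messages P U) (A.guessTest r v t) =
        0 := by
      simp only [viewAccept, Attacker.guessTest, acceptProb_pure, Computes.testOutput_eq_one_iff,
        hfalse, if_false, expect_const]
    rw [hzero]
    exact add_nonneg (viewAccept_nonneg _ _ _) hε

theorem guess_apply_le {a : ℕ} {ε : ℝ} (hε : 0 ≤ ε) {U U' : F.Updates} (A : Attacker)
    (h : ∀ W, Feasible W (guessCost a A.size (A.size + P.q.size + a + 1)) →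
      |viewAccept F P C dec (F.leakage P C dec U) (messages P U) W -
        viewAccept F P C dec (F.leakage P C dec U') (messages P U') W| ≤ ε)
    {v : List ℕ} (hv : bitLength v ≤ a) (t : List ℕ) :
    ((F.view P C dec U).bind fun w => (A.run (w ++ v)).map fun y => decide (y = t)) true ≤
      ((F.view P C dec U').bind fun w => (A.run (w ++ v)).map fun y => decide (y = t)) true +
        ENNReal.ofReal ε := by
  rw [← ENNReal.toReal_le_toReal (PMF.apply_ne_top _ _)
    (ENNReal.add_ne_top.mpr ⟨PMF.apply_ne_top _ _, ENNReal.ofReal_ne_top⟩),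
    ENNReal.toReal_add (PMF.apply_ne_top _ _) ENNReal.ofReal_ne_top, ENNReal.toReal_ofReal hε,
    toReal_guess_apply, toReal_guess_apply]
  set μ := PMF.uniformOfFintype (Fin A.coins → Fin 2)
  rw [← expect_const μ ε, expect, expect, expect, ← Finset.sum_add_distrib]
  refine Finset.sum_le_sum fun r _ => ?_
  rw [← mul_add]
  exact mul_le_mul_of_nonneg_left (viewAccept_guessTest_le hε A h r hv t) ENNReal.toReal_nonneg

/-- An attacker on a view that depends on the private data through `L` only does not beat the best
guess from `L`. -/
theorem bind_guess_apply_le {Ω L : Type} (D : PMF Ω) (ℓ : Ω → L) (τ : Ω → List ℕ)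
    (U : L → F.Updates) (v : L → List ℕ) (A : Attacker) :
    (D.bind fun ω => (F.view P C dec (U (ℓ ω))).bind fun w =>
      (A.run (w ++ v (ℓ ω))).map fun y => decide (y = τ ω)) true ≤
      ⨆ g : L → List ℕ, (D.map fun ω => decide (g (ℓ ω) = τ ω)) true := by
  simp only [view_eq, Attacker.run, PMF.bind_bind, PMF.bind_map, PMF.map_comp,
    Function.comp_def]
  rw [PMF.bind_comm]
  refine PMF.bind_apply_le _ _ _ fun keys => ?_
  rw [PMF.bind_comm]
  refine PMF.bind_apply_le _ _ _ fun ρ => ?_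
  simp only [← PMF.bind_pure_comp, Function.comp_def]
  rw [PMF.bind_comm]
  refine PMF.bind_apply_le _ _ _ fun r => ?_
  exact le_iSup (fun g : L → List ℕ => (D.bind fun ω => PMF.pure (decide (g (ℓ ω) = τ ω))) true)
    fun l => A.runWith r (viewWords F P C dec (F.leakage P C dec (U l))
      (ciphertexts (messages P (U l)) keys.1 ρ) keys.1 ρ ++ v l)

theorem inferenceProb_le {a : ℕ} {ε : ℝ} (hε : 0 ≤ ε) {Ω : Type} (D : PMF Ω) (U : Ω → F.Updates)
    (aux τ : Ω → List ℕ) (haux : ∀ ω, bitLength (aux ω) ≤ a) (A : Attacker)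
    (h : ∀ U U' : F.Updates, F.leakage P C dec U = F.leakage P C dec U' →
      ∀ W, Feasible W (guessCost a A.size (A.size + P.q.size + a + 1)) →
        |viewAccept F P C dec (F.leakage P C dec U) (messages P U) W -
          viewAccept F P C dec (F.leakage P C dec U') (messages P U') W| ≤ ε) :
    inferenceProb F P C dec D U aux τ A ≤
      guessProb D (fun ω => (aux ω, F.leakage P C dec (U ω))) τ + ε := by
  have : Nonempty Ω := ⟨D.support_nonempty.some⟩
  set L : Ω → List ℕ × _ := fun ω => (aux ω, F.leakage P C dec (U ω)) with hL
  have hrep : ∀ ω, L (Function.invFun L (L ω)) = L ω := fun ω => Function.invFun_eq ⟨ω, rfl⟩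
  have h1 := PMF.bind_apply_le_bind_apply_add D _ _ true fun ω =>
    guess_apply_le hε A (h (U ω) (U (Function.invFun L (L ω)))
      (congrArg Prod.snd (hrep ω)).symm) (haux ω) (τ ω)
  have h2 := bind_guess_apply_le (P := P) (C := C) (dec := dec) D L τ
    (fun l => U (Function.invFun L l)) Prod.fst A
  have h3 : (⨆ g : _ → List ℕ, (D.map fun ω => decide (g (L ω) = τ ω)) true) ≠ ⊤ :=
    ne_top_of_le_ne_top ENNReal.one_ne_top (iSup_le fun g => PMF.coe_le_one _ _)
  have h4 := h1.trans (add_le_add_left h2 _)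
  rw [inferenceProb, guessProb]
  refine (ENNReal.toReal_mono (ENNReal.add_ne_top.mpr ⟨h3, ENNReal.ofReal_ne_top⟩) h4).trans_eq ?_
  rw [ENNReal.toReal_add h3 ENNReal.ofReal_ne_top, ENNReal.toReal_ofReal hε]

end FedShield

theorem guessProb_uniform_le {X L : Type} [Fintype X] [Nonempty X] {ℓ : X → L}
    (hℓ : ∀ x x', ℓ x = ℓ x') {name : X → List ℕ} (hname : Function.Injective name) :
    guessProb (PMF.uniformOfFintype X) ℓ name ≤ 1 / (Fintype.card X : ℝ) := by
  classical
  have h : (⨆ g : L → List ℕ,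
      ((PMF.uniformOfFintype X).map fun x => decide (g (ℓ x) = name x)) true) ≤
      (Fintype.card X : ENNReal)⁻¹ := by
    refine iSup_le fun g => ?_
    rw [PMF.map_apply, tsum_fintype]
    by_cases hx : ∃ x₀, g (ℓ x₀) = name x₀
    · obtain ⟨x₀, hx₀⟩ := hx
      rw [Finset.sum_eq_single x₀]
      · simp [hx₀]
      · intro x _ hne
        have : g (ℓ x) ≠ name x := fun hx => hne (hname (by rw [← hx, ← hx₀, hℓ x x₀]))
        simp [this]
      · simp
    · push Not at hx
      simp [hx]
  have hcard : (Fintype.card X : ENNReal)⁻¹ ≠ ⊤ :=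
    ENNReal.inv_ne_top.mpr (Nat.cast_ne_zero.mpr Fintype.card_ne_zero)
  refine (ENNReal.toReal_mono hcard h).trans_eq ?_
  rw [ENNReal.toReal_inv, ENNReal.toReal_natCast, one_div]

/-! ### Sparse aggregates -/

section Aggregate

variable {d r k : ℕ} {p : ℝ}

theorem ClientUpdate.ncard_pruned_ne_zero_le (U : ClientUpdate d r k p) :
    {x : Fin d × Fin k | U.pruned x.1 x.2 ≠ 0}.ncard ≤ d * k - ⌊p * (d * k : ℕ)⌋₊ := by
  have hsub : {x : Fin d × Fin k | U.pruned x.1 x.2 ≠ 0} ⊆ (U.kept : Set (Fin d × Fin k)) := by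
    intro x hx
    by_contra hc
    exact hx (if_neg hc)
  refine (Set.ncard_le_ncard hsub).trans ?_
  rw [Set.ncard_coe_finset, ← U.card_dropped, Finset.card_compl, Fintype.card_prod,
    Fintype.card_fin, Fintype.card_fin]
  have : U.kept.card ≤ d * k := by
    simpa using Finset.card_le_univ U.kept
  omega

theorem maskMul_add {S : Finset (Fin d × Fin k)} (V W : Matrix (Fin d) (Fin k) ℝ) :
    maskMul S (V + W) = maskMul S V + maskMul S W := by
  ext i j
  by_cases h : (i, j) ∈ S <;> simp [maskMul, h]

theorem maskMul_single_of_notMem {S : Finset (Fin d × Fin k)} {x : Fin d × Fin k} (hx : x ∉ S)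
    (c : ℝ) : maskMul S (Matrix.single x.1 x.2 c) = 0 := by
  ext i j
  by_cases h : (i, j) ∈ S
  · have : ¬(x.1 = i ∧ x.2 = j) := by
      rintro ⟨rfl, rfl⟩
      exact hx h
    simp [maskMul, h, Matrix.single_apply, this]
  · simp [maskMul, h]

theorem maskMul_single_of_mem {S : Finset (Fin d × Fin k)} {x : Fin d × Fin k} (hx : x ∈ S)
    (c : ℝ) : maskMul S (Matrix.single x.1 x.2 c) = Matrix.single x.1 x.2 c := by
  ext i j
  by_cases h : (i, j) ∈ S
  · simp [maskMul, h]
  · have : ¬(x.1 = i ∧ x.2 = j) := by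
      rintro ⟨rfl, rfl⟩
      exact h hx
    simp [maskMul, h, Matrix.single_apply, this]

/-- The sum of masked matrices does not determine the matrices of the clients in `H`, if some mask
drops an entry or if there are two clients in `H`. -/
theorem exists_ne_of_sum_maskMul_eq {ι : Type} [DecidableEq ι] {S H : Finset ι} (hHS : H ⊆ S)
    (hH : H.Nonempty) (mask : ι → Finset (Fin d × Fin k)) (V : ι → Matrix (Fin d) (Fin k) ℝ)
    (h : (∀ i ∈ H, (mask i)ᶜ.Nonempty) ∨ 2 ≤ H.card ∧ 0 < d * k) :
    ∃ W : ι → Matrix (Fin d) (Fin k) ℝ, W ≠ V ∧ (∀ i, i ∉ H → W i = V i) ∧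
      ∑ i ∈ S, maskMul (mask i) (W i) = ∑ i ∈ S, maskMul (mask i) (V i) := by
  have hsingle : ∀ x : Fin d × Fin k, (Matrix.single x.1 x.2 1 : Matrix _ _ ℝ) ≠ 0 := by
    intro x hx
    have := congrFun (congrFun hx x.1) x.2
    simp at this
  by_cases hdrop : ∃ i ∈ H, ∃ x, x ∉ mask i
  · obtain ⟨i, hi, x, hx⟩ := hdrop
    refine ⟨Function.update V i (V i + Matrix.single x.1 x.2 1), ?_, ?_, ?_⟩
    · intro heq
      have := congrFun heq i
      rw [Function.update_self, add_eq_left] at this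
      exact hsingle x this
    · intro j hj
      exact Function.update_of_ne (ne_of_mem_of_not_mem hi hj).symm _ _
    · refine Finset.sum_congr rfl fun j _ => ?_
      by_cases hji : j = i
      · subst hji
        rw [Function.update_self, maskMul_add, maskMul_single_of_notMem hx, add_zero]
      · rw [Function.update_of_ne hji]
  · push Not at hdrop
    rcases h with h | ⟨hcard, hdk⟩
    · obtain ⟨i, hi⟩ := hH
      obtain ⟨x, hx⟩ := h i hi
      exact absurd (hdrop i hi x) (Finset.mem_compl.mp hx)
    · obtain ⟨i, hi, j, hj, hij⟩ := Finset.one_lt_card.mp hcard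
      have hd : 0 < d := Nat.pos_of_mul_pos_right hdk
      have hk : 0 < k := Nat.pos_of_mul_pos_left hdk
      set x : Fin d × Fin k := (⟨0, hd⟩, ⟨0, hk⟩)
      set E : Matrix (Fin d) (Fin k) ℝ := Matrix.single x.1 x.2 1 with hE
      set δ : ι → Matrix (Fin d) (Fin k) ℝ := fun l =>
        (if l = i then E else 0) - (if l = j then E else 0) with hδ
      have hmask : ∀ l ∈ S, maskMul (mask l) (V l + δ l) = maskMul (mask l) (V l) + δ l := by
        intro l _
        rw [maskMul_add]
        congr 1
        have hzero : maskMul (mask l) (0 : Matrix (Fin d) (Fin k) ℝ) = 0 := by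
          ext
          simp [maskMul]
        have hneg : ∀ c : ℝ, l = i ∨ l = j → maskMul (mask l) (Matrix.single x.1 x.2 c) =
            Matrix.single x.1 x.2 c := by
          rintro c (rfl | rfl)
          · exact maskMul_single_of_mem (hdrop _ hi x) c
          · exact maskMul_single_of_mem (hdrop _ hj x) c
        by_cases hli : l = i
        · have hlj : l ≠ j := hli ▸ hij
          simp only [hδ, if_pos hli, if_neg hlj, sub_zero]
          exact hneg 1 (Or.inl hli)
        · by_cases hlj : l = j
          · simp only [hδ, if_neg hli, if_pos hlj, zero_sub, hE]
            have hsn : -(Matrix.single x.1 x.2 1 : Matrix (Fin d) (Fin k) ℝ) =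
                Matrix.single x.1 x.2 (-1) := by
              ext
              simp only [Matrix.neg_apply, Matrix.single_apply]
              split_ifs <;> simp
            rw [hsn]
            exact hneg (-1) (Or.inr hlj)
          · simp only [hδ, if_neg hli, if_neg hlj, sub_zero]
            exact hzero
      refine ⟨fun l => V l + δ l, ?_, ?_, ?_⟩
      · intro heq
        have := congrFun heq i
        simp only [add_eq_left, hδ, if_true, if_neg hij, sub_zero] at this
        exact hsingle x this
      · intro l hl
        have hli : l ≠ i := fun h => hl (h ▸ hi)
        have hlj : l ≠ j := fun h => hl (h ▸ hj)
        simp [hδ, hli, hlj]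
      · rw [Finset.sum_congr rfl hmask, Finset.sum_add_distrib]
        simp [hδ, hHS hi, hHS hj]

end Aggregate

/-! ### The main theorem -/

theorem theorem2
    (P : ℕ → CKKS) (F : ℕ → FedShield)
    (hdegree : PolyBounded fun sec => (P sec).degree)
    (hq : PolyBounded fun sec => (P sec).q.size)
    (hclients : PolyBounded fun sec => (F sec).clients)
    (hrounds : PolyBounded fun sec => (F sec).rounds)
    (hd : PolyBounded fun sec => (F sec).d)
    (hk : PolyBounded fun sec => (F sec).k) :
    -- semantic security of CKKS under Ring-LWE
    (RLWEHard P (fun sec => (P sec).χs) 1 → RLWEHard P (fun sec => (P sec).χu) 2 →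
      INDCPASecure P) ∧
    -- security of the protocol against the server and any set `C` of colluding clients,
    -- without (`dec = false`) and with (`dec = true`) access to the decrypted aggregates
    (INDCPASecure P → ∀ (C : ∀ sec, Finset (Fin (F sec).clients)) (dec : Bool),
      -- indistinguishability of the individual updates
      (∀ U U' : ∀ sec, (F sec).Updates,
        (∀ sec, (F sec).leakage (P sec) (C sec) dec (U sec) =
          (F sec).leakage (P sec) (C sec) dec (U' sec)) →
        ∀ A : ℕ → Attacker, PolyTime A → Negligible fun sec =>
          |acceptProb (((F sec).view (P sec) (C sec) dec (U sec)).bind (A sec).run) -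
            acceptProb (((F sec).view (P sec) (C sec) dec (U' sec)).bind (A sec).run)|) ∧
      -- inference attacks
      (∀ (Ω : ℕ → Type) (D : ∀ sec, PMF (Ω sec)) (U : ∀ sec, Ω sec → (F sec).Updates)
        (aux τ : ∀ sec, Ω sec → List ℕ) (a : ℕ → ℕ), PolyBounded a →
        (∀ sec ω, bitLength (aux sec ω) ≤ a sec) →
        ∀ A : ℕ → Attacker, PolyTime A →
          ∃ ε : ℕ → ℝ, Negligible ε ∧ ∀ sec,
            inferenceProb (F sec) (P sec) (C sec) dec (D sec) (U sec) (aux sec) (τ sec) (A sec) ≤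
              guessProb (D sec)
                (fun ω => (aux sec ω, (F sec).leakage (P sec) (C sec) dec (U sec ω)))
                (τ sec) + ε sec) ∧
      -- in particular, a uniformly random data point on which nothing but the encrypted updates
      -- depends is found with no more than the probability of a random guess
      (∀ (X : ℕ → Type) [∀ sec, Fintype (X sec)] [∀ sec, Nonempty (X sec)]
        (U : ∀ sec, X sec → (F sec).Updates) (name : ∀ sec, X sec → List ℕ),
        (∀ sec, Function.Injective (name sec)) →
        (∀ sec x x', (F sec).leakage (P sec) (C sec) dec (U sec x) =
          (F sec).leakage (P sec) (C sec) dec (U sec x')) →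
        ∀ A : ℕ → Attacker, PolyTime A →
          ∃ ε : ℕ → ℝ, Negligible ε ∧ ∀ sec,
            inferenceProb (F sec) (P sec) (C sec) dec (PMF.uniformOfFintype (X sec)) (U sec)
                (fun _ => []) (name sec) (A sec) ≤ 1 / (Fintype.card (X sec) : ℝ) + ε sec)) ∧
    -- the aggregate of a round leaves the updates of the honest clients `H` underdetermined
    (∀ sec (t : Fin (F sec).rounds)
      (U : Fin (F sec).clients → ClientUpdate (F sec).d (F sec).r (F sec).k ((F sec).rate t)),
      (∀ i, (U i).lora.rank ≤ (F sec).r ∧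
        {x : Fin (F sec).d × Fin (F sec).k | (U i).pruned x.1 x.2 ≠ 0}.ncard ≤
          (F sec).d * (F sec).k - ⌊(F sec).rate t * ((F sec).d * (F sec).k : ℕ)⌋₊) ∧
      ∀ H ⊆ (F sec).participants t, H.Nonempty →
        (1 ≤ (F sec).rate t * ((F sec).d * (F sec).k : ℕ) ∨
          (2 ≤ H.card ∧ 0 < (F sec).d * (F sec).k)) →
        ∃ W : Fin (F sec).clients → Matrix (Fin (F sec).d) (Fin (F sec).k) ℝ,
          W ≠ (fun i => (U i).lora) ∧ (∀ i, i ∉ H → W i = (U i).lora) ∧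
          ∑ i ∈ (F sec).participants t, maskMul (U i).kept (W i) =
            ∑ i ∈ (F sec).participants t, (U i).pruned) := by
  refine ⟨fun h₁ h₂ => INDCPASecure.of_rlweHard hdegree hq h₁ h₂, ?_, ?_⟩
  · intro hcpa C dec
    have hbound := fun {w : ℕ → ℕ} (hw : PolyBounded w) =>
      FedShield.exists_view_bound hcpa hdegree hq hclients hrounds hd hk hw
    have hinfer : ∀ (Ω : ℕ → Type) (D : ∀ sec, PMF (Ω sec)) (U : ∀ sec, Ω sec → (F sec).Updates)
        (aux τ : ∀ sec, Ω sec → List ℕ) (a : ℕ → ℕ), PolyBounded a →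
        (∀ sec ω, bitLength (aux sec ω) ≤ a sec) →
        ∀ A : ℕ → Attacker, PolyTime A →
          ∃ ε : ℕ → ℝ, Negligible ε ∧ ∀ sec,
            inferenceProb (F sec) (P sec) (C sec) dec (D sec) (U sec) (aux sec) (τ sec) (A sec) ≤
              guessProb (D sec)
                (fun ω => (aux sec ω, (F sec).leakage (P sec) (C sec) dec (U sec ω)))
                (τ sec) + ε sec := by
      intro Ω D U aux τ a ha haux A hA
      have hw : PolyBounded fun sec => guessCost (a sec) (A sec).size
          ((A sec).size + (P sec).q.size + a sec + 1) :=
        (((PolyBounded.const 2).mul ha).add ((PolyBounded.const 3).mul hA)).add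
          ((PolyBounded.mul hA (((PolyBounded.const 2).mul ((((PolyBounded.add hA hq).add ha).add
            (PolyBounded.const 1)).add (PolyBounded.const 5))).add (PolyBounded.const 16))).add
              (PolyBounded.const 3))
      obtain ⟨ε, hε, hε0, hle⟩ := hbound hw
      exact ⟨ε, hε, fun sec => FedShield.inferenceProb_le (hε0 sec) (D sec) (U sec) (aux sec)
        (τ sec) (haux sec) (A sec) (hle sec (C sec) dec)⟩
    refine ⟨fun U U' hU A hA => ?_, hinfer, fun X _ _ U name hname hU A hA => ?_⟩
    · obtain ⟨ε, hε, hε0, hle⟩ := hbound (w := fun sec => 3 * (A sec).size)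
        ((PolyBounded.const 3).mul hA)
      refine hε.of_abs_le fun sec => ?_
      rw [abs_abs, abs_of_nonneg (hε0 sec), FedShield.acceptProb_view_bind,
        FedShield.acceptProb_view_bind]
      exact abs_expect_sub_le _ fun r =>
        hle sec (C sec) dec _ _ (hU sec) _ ((A sec).feasible_runWith r)
    · obtain ⟨ε, hε, hle⟩ := hinfer X (fun sec => PMF.uniformOfFintype (X sec)) U
        (fun _ _ => []) name (fun _ => 0) (PolyBounded.const 0) (fun _ _ => by simp [bitLength])
        A hA
      refine ⟨ε, hε, fun sec => (hle sec).trans (add_le_add_left ?_ _)⟩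
      exact guessProb_uniform_le (fun x x' => by rw [hU sec x x']) (hname sec)
  · intro sec t U
    refine ⟨fun i => ⟨?_, (U i).ncard_pruned_ne_zero_le⟩, fun H hH hne h => ?_⟩
    · exact (Matrix.rank_mul_le_left _ _).trans
        ((Matrix.rank_le_card_width _).trans_eq (Fintype.card_fin _))
    · refine exists_ne_of_sum_maskMul_eq hH hne (fun i => (U i).kept) (fun i => (U i).lora)
        (h.imp (fun h1 i _ => ?_) id)
      rw [← Finset.card_pos, (U i).card_dropped]
      exact Nat.floor_pos.mpr h1
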